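/- For $n\ge 1$, $k\ge 1$ let $H_k^{(n)}=\sum_{i=1}^k i^{-n}$ and $h_k^{(n)}=\sum_{i=1}^k(2i-1)^{-n}$, and consider $$S_{n,m}=\sum_{k\ge1}\frac{H_k^{(n)}}{k^m},\quad T^1_{n,m}=\sum_{k\ge1}\frac{h_k^{(n)}}{k^m},\quad T^2_{n,m}=\sum_{k\ge1}\frac{H_k^{(m)}}{(2k-1)^n},\quad T^3_{n,m}=\sum_{k\ge1}\frac{h_k^{(n)}}{(2k-1)^m},$$ $$T^4_{n,m}=\sum_{k\ge1}\frac{h_k^{(m)}}{(2k-1)^n},\quad T^5_{n,m}=\sum_{k\ge1}\frac{h_k^{(m)}}{k^n},\quad T^6_{n,m}=\sum_{k\ge1}\frac{H_k^{(n)}}{(2k-1)^m},\quad D_{n,m}=\sum_{k\ge1}\frac{1}{k^n(2k-1)^m}.$$ Let $\lambda(s)=(1-2^{-s})\zeta(s)$ and let $\mathcal Z=\mathbb Q[\zeta(2),\zeta(3),\zeta(4),\dots]\subset\mathbb R$ be the ring of polynomial expressions in zeta values with rational coefficients. Let the weight $n+m$ be odd. All these series converge when the order of the harmonic number is at least $1$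 and the exponent in the denominator is at least $2$ (that is, $n\ge1$, $m\ge2$ for $S,T^1,T^3,T^6,D$ and $m\ge1$, $n\ge2$ for $T^2,T^4,T^5$). Throughout, indices are restricted to this range. 1. (Recursive computation of $T^1$.) For $q\ge1$, $$T^1_{1,2q}=\frac{2^{2q+1}-1}{4}\,\zeta(2q+1)-\frac12\sum_{j=1}^{q-1}(2^{2j+1}-1)\,\zeta(2j+1)\,\zeta(2q-2j),$$ and for $n\ge1$, $m\ge2$ with $n+1+m$ odd, $$n\,T^1_{n+1,m}=2\sum_{i=1}^{\lfloor n/2\rfloor}\lambda(2i)\,T^1_{n+1-2i,m}+\sum_{i=1}^{\lfloor (m-1)/2\rfloor}\zeta(2i)\,T^1_{n,m+1-2i}-\frac{m+1}{2}\,T^1_{n,m+1}.$$ Consequently every $T^1_{n,m}$ of odd weight with $n\ge1$, $m\ge2$ lies in $\mathcal Z$. 2. (Related families.) $T^2_{n,m}=T^6_{m,n}$, $T^4_{n,m}=T^3_{m,n}$ and $T^5_{n,m}=T^1_{m,n}$. For odd $n+m$, $$T^6_{n,m}=\zeta(n)\lambda(m)+D_{n,m}-T^1_{m,n}\quad(n,m\ge2),$$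 $$T^3_{n,m}=(1-2^{-n-m})S_{n,m}-2^{-m}T^1_{n,m}-2^{-n}\left(T^6_{n,m}-D_{n,m}\right)\quad(n\ge1,\ m\ge2).$$ Every $T^5_{n,m}$ of odd weight with $n\ge2$, $m\ge1$ lies in $\mathcal Z$. If $n,m\ge2$ and $n+m$ is odd, then $T^3_{n,m},T^4_{n,m}\in\mathcal Z$ and $T^2_{n,m},T^6_{n,m}\in\mathcal Z+\mathbb Q\ln 2$. If the order of the harmonic number is $1$ (and the weight is odd), then $T^3_{1,m},T^6_{1,m}$ $(m\ge2)$ and $T^2_{n,1},T^4_{n,1}$ $(n\ge2)$ lie in $\mathcal Z[\ln2]$. -/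

import Mathlib

namespace OddEuler

/-- The value `ζ(s)` at a natural number `s`, as a real number. It is only used for `s ≥ 2`, where
`ζ(s)` is real (see `ofReal_zetaVal`). -/
noncomputable def zetaVal (s : ℕ) : ℝ := (riemannZeta (s : ℂ)).re

theorem zetaVal_eq_tsum {s : ℕ} (hs : 2 ≤ s) : zetaVal s = ∑' k : ℕ, 1 / (k : ℝ) ^ s := by
  have h : riemannZeta (s : ℂ) = ((∑' k : ℕ, 1 / (k : ℝ) ^ s : ℝ) : ℂ) := by
    rw [zeta_nat_eq_tsum_of_gt_one (by omega)]
    push_cast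
    rfl
  rw [zetaVal, h, Complex.ofReal_re]

theorem ofReal_zetaVal {s : ℕ} (hs : 2 ≤ s) : (zetaVal s : ℂ) = riemannZeta (s : ℂ) := by
  rw [zetaVal_eq_tsum hs, zeta_nat_eq_tsum_of_gt_one (by omega)]
  push_cast
  rfl

/-- The value `λ(s) = (1 - 2⁻ˢ) ζ(s) = ∑_{k ≥ 1} 1 / (2k - 1)ˢ`. -/
noncomputable def lambdaVal (s : ℕ) : ℝ := (1 - 1 / 2 ^ s) * zetaVal s

/-- The set of zeta values `ζ(2), ζ(3), ζ(4), …`. -/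
def zetaValues : Set ℝ := {x | ∃ s : ℕ, 2 ≤ s ∧ x = zetaVal s}

/-- The real numbers that are expressible in terms of zeta values only: the polynomial
expressions in `ζ(2), ζ(3), ζ(4), …` with rational coefficients. -/
noncomputable def zetaAlg : Subalgebra ℚ ℝ := Algebra.adjoin ℚ zetaValues

/-- The polynomial expressions in `ln 2` and `ζ(2), ζ(3), ζ(4), …` with rational coefficients. -/
noncomputable def zetaLogAlg : Subalgebra ℚ ℝ := Algebra.adjoin ℚ (insert (Real.log 2) zetaValues)

/-- The harmonic number `H_k^{(n)} = ∑_{i=1}^k 1 / iⁿ`. -/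
noncomputable def harm (n k : ℕ) : ℝ := ∑ i ∈ Finset.Icc 1 k, 1 / (i : ℝ) ^ n

/-- The odd harmonic number `h_k^{(n)} = ∑_{i=1}^k 1 / (2i - 1)ⁿ`. -/
noncomputable def oddHarm (n k : ℕ) : ℝ := ∑ i ∈ Finset.Icc 1 k, 1 / (2 * (i : ℝ) - 1) ^ n

/-! The terms of the series below; the series run over `k ≥ 1`. -/

/-- `H_k^{(n)} / kᵐ` -/
noncomputable def termS (n m k : ℕ) : ℝ := harm n k / (k : ℝ) ^ m

/-- `1 / (kⁿ (2k - 1)ᵐ)` -/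
noncomputable def termD (n m k : ℕ) : ℝ := 1 / ((k : ℝ) ^ n * (2 * (k : ℝ) - 1) ^ m)

/-- `h_k^{(n)} / kᵐ` -/
noncomputable def term1 (n m k : ℕ) : ℝ := oddHarm n k / (k : ℝ) ^ m

/-- `H_k^{(m)} / (2k - 1)ⁿ` -/
noncomputable def term2 (n m k : ℕ) : ℝ := harm m k / (2 * (k : ℝ) - 1) ^ n

/-- `h_k^{(n)} / (2k - 1)ᵐ` -/
noncomputable def term3 (n m k : ℕ) : ℝ := oddHarm n k / (2 * (k : ℝ) - 1) ^ m

/-- `h_k^{(m)} / (2k - 1)ⁿ` -/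
noncomputable def term4 (n m k : ℕ) : ℝ := oddHarm m k / (2 * (k : ℝ) - 1) ^ n

/-- `h_k^{(m)} / kⁿ` -/
noncomputable def term5 (n m k : ℕ) : ℝ := oddHarm m k / (k : ℝ) ^ n

/-- `H_k^{(n)} / (2k - 1)ᵐ` -/
noncomputable def term6 (n m k : ℕ) : ℝ := harm n k / (2 * (k : ℝ) - 1) ^ m

/-- `∑_{k ≥ 1} a k`, of use only when the series converges. -/
noncomputable def series (a : ℕ → ℝ) : ℝ := ∑' k : ℕ, a (k + 1)

/-- Convergence of `∑_{k ≥ 1} a k` (all the series here have non-negative terms). -/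
def Converges (a : ℕ → ℝ) : Prop := Summable fun k : ℕ => a (k + 1)

/-- The Euler sum `S_{n,m}`. -/
noncomputable def S (n m : ℕ) : ℝ := series (termS n m)

/-- The elementary sum `D_{n,m} = ∑_{k ≥ 1} 1 / (kⁿ (2k - 1)ᵐ)`. -/
noncomputable def D (n m : ℕ) : ℝ := series (termD n m)

/-- The odd-type Euler sum `T¹_{n,m}`. -/
noncomputable def T1 (n m : ℕ) : ℝ := series (term1 n m)

/-- The odd-type Euler sum `T²_{n,m}`. -/
noncomputable def T2 (n m : ℕ) : ℝ := series (term2 n m)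

/-- The odd-type Euler sum `T³_{n,m}`. -/
noncomputable def T3 (n m : ℕ) : ℝ := series (term3 n m)

/-- The odd-type Euler sum `T⁴_{n,m}`. -/
noncomputable def T4 (n m : ℕ) : ℝ := series (term4 n m)

/-- The odd-type Euler sum `T⁵_{n,m}`. -/
noncomputable def T5 (n m : ℕ) : ℝ := series (term5 n m)

/-- The odd-type Euler sum `T⁶_{n,m}`. -/
noncomputable def T6 (n m : ℕ) : ℝ := series (term6 n m)

end OddEuler

open OddEuler

/-!
Write `H` and `h` for the harmonic and odd harmonic numbers, and read `1 / 0` as `0`, so that sums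
may run over all of `ℤ`.

**From half-lines to lines.** Fix an odd number `a > 0` and put `u_k = 1 / aⁿ - 1 / (a + 2k)ⁿ` for
`k ∈ ℤ`. Summing `u_k` over all odd `a > 0` telescopes: it gives `h_k^{(n)}` for `k > 0`, and
`-(-1)ⁿ h_{-k}^{(n)}` for `k < 0`. Hence, when `n + m` is odd, the sum over all `a` of
`U_a(n, m) = ∑_{k ∈ ℤ} u_k / kᵐ` is `2 T¹_{n,m}` (`hasSum_oddU_T1`). The interchange of summations
is absolutely convergent, because `1 / |x y (x + y)|` is summable over pairs of integers
(`summable_inv_mul_inv_mul_inv_add`, `summable_eulerTerm`).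

**The recursion** holds for every `U_a` separately (`oddU_recursion`). It comes from summing the
kernel `u_j / (kᵐ⁻¹ j (k - j))` over `j` and `k` in both orders. The inner sums are those of
Euler's proof of the formula for `∑ ζ(2i) ζ(2q - 2i)`: by partial fractions, and because `1 / j`
and `1 / (2j + 1)` have symmetric sum zero over `ℤ`, the sums `∑_j 1 / (jᵐ (k - j))` and
`∑_c 1 / (cⁿ (b - c))`, over `j ∈ ℤ` and over odd `c`, are explicit combinations of even zeta and
lambda values (`hasSum_inv_pow_mul_inv_sub`, `hasSum_inv_odd_pow_mul_inv_sub`). The starting values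
`T¹_{1,2q}` come from partial fractions for `∑_k 1 / (k^{2q-1} (a + 2k))` (`T1_one`), and induction
on `n` gives `T1_mem_zetaAlg`.

**The other families.** `T6_eq` is the product of two series, split along its diagonal, and `T3_eq`
separates the parities of the denominators in `S_{n,m}`. The sums `D_{n,m}` reduce by partial
fractions to zeta values and `D_{1,1} = 2 ln 2` (`exists_D_sub_log_mem`). What remains is `S_{n,m}`
in odd weight and `T⁶_{1,m}`. Both are again sums over `x > 0` of sums over a symmetric progression
of `y`, now of `(1 / xⁿ - 1 / (x + y)ⁿ) / yᵐ`; partial fractions turn the inner sum into a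
combination of inverse powers of `x` of exponent at least two, with coefficients in the ring of zeta
values (`PartialFractionPair`, `exists_hasSum_eulerTerm_int`). In the case of `T⁶_{1,m}`, where `x`
and `y` are odd, the sum over `x` contributes the constant `ln 2 = ∑ (1 / (2i + 1) - 1 / (2i + 2))`
(`hasSum_eulerTerm_T6`).
-/

namespace OddEuler

/-! ### Zeta and lambda values as sums over the integers -/

theorem hasSum_of_eq {ι : Type*} {f g : ι → ℝ} {s : ℝ} (h : HasSum f s) (e : ∀ i, f i = g i) :
    HasSum g s := by
  rwa [show g = f from funext fun i => (e i).symm]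

theorem hasSum_of_eq_of_eq {ι : Type*} {f g : ι → ℝ} {s t : ℝ} (h : HasSum f s)
    (e : ∀ i, f i = g i) (hs : s = t) : HasSum g t :=
  hs ▸ hasSum_of_eq h e

theorem harm_eq_sum_range (n k : ℕ) :
    harm n k = ∑ i ∈ Finset.range k, ((i + 1 : ℝ)⁻¹) ^ n := by
  induction k with
  | zero => simp [harm]
  | succ k ih =>
    rw [Finset.sum_range_succ, ← ih, harm, harm, Finset.sum_Icc_succ_top (by omega)]
    simp

theorem oddHarm_eq_sum_range (n k : ℕ) :
    oddHarm n k = ∑ i ∈ Finset.range k, ((2 * i + 1 : ℝ)⁻¹) ^ n := by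
  induction k with
  | zero => simp [oddHarm]
  | succ k ih =>
    rw [Finset.sum_range_succ, ← ih, oddHarm, oddHarm, Finset.sum_Icc_succ_top (by omega)]
    push_cast
    rw [show (2 * ((k : ℝ) + 1) - 1) = 2 * k + 1 by ring]
    simp

theorem summable_inv_nat_pow {s : ℕ} (hs : 2 ≤ s) : Summable fun k : ℕ => ((k : ℝ)⁻¹) ^ s := by
  simpa [inv_pow] using (Real.summable_nat_pow_inv (p := s)).2 (by omega)

theorem hasSum_zetaVal {s : ℕ} (hs : 2 ≤ s) :
    HasSum (fun k : ℕ => ((k : ℝ)⁻¹) ^ s) (zetaVal s) := by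
  rw [zetaVal_eq_tsum hs]
  simpa [inv_pow] using (summable_inv_nat_pow hs).hasSum

theorem hasSum_zetaVal_succ {s : ℕ} (hs : 2 ≤ s) :
    HasSum (fun k : ℕ => ((k + 1 : ℝ)⁻¹) ^ s) (zetaVal s) := by
  have h := (hasSum_nat_add_iff' (f := fun k : ℕ => ((k : ℝ)⁻¹) ^ s) 1).2 (hasSum_zetaVal hs)
  simpa [show s ≠ 0 by omega] using h

theorem hasSum_lambdaVal {s : ℕ} (hs : 2 ≤ s) :
    HasSum (fun k : ℕ => ((2 * k + 1 : ℝ)⁻¹) ^ s) (lambdaVal s) := by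
  have he : HasSum (fun k : ℕ => (((2 * k : ℕ) : ℝ)⁻¹) ^ s) (1 / 2 ^ s * zetaVal s) := by
    refine hasSum_of_eq ((hasSum_zetaVal hs).mul_left (1 / 2 ^ s)) fun k => ?_
    push_cast
    rw [mul_inv, mul_pow, inv_pow 2]
    ring
  have hso : Summable fun k : ℕ => (((2 * k + 1 : ℕ) : ℝ)⁻¹) ^ s :=
    (summable_inv_nat_pow hs).comp_injective (i := fun k : ℕ => 2 * k + 1)
      fun a b h => by dsimp only at h; omega
  have hval := (HasSum.even_add_odd (f := fun k : ℕ => ((k : ℝ)⁻¹) ^ s) he hso.hasSum).unique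
    (hasSum_zetaVal hs)
  have hl : lambdaVal s = ∑' k : ℕ, (((2 * k + 1 : ℕ) : ℝ)⁻¹) ^ s := by
    rw [lambdaVal]; linarith
  rw [hl]
  exact hasSum_of_eq hso.hasSum fun k => by push_cast; rfl

theorem summable_inv_int_pow {s : ℕ} (hs : 2 ≤ s) : Summable fun k : ℤ => ((k : ℝ)⁻¹) ^ s := by
  simpa [inv_pow] using (Real.summable_one_div_int_pow (p := s)).2 (by omega)

theorem hasSum_int_inv_pow {s : ℕ} (hs : 2 ≤ s) :
    HasSum (fun k : ℤ => ((k : ℝ)⁻¹) ^ s) ((1 + (-1) ^ s) * zetaVal s) := by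
  rw [add_mul, one_mul]
  refine HasSum.of_nat_of_neg_add_one (by simpa using hasSum_zetaVal hs) ?_
  refine hasSum_of_eq ((hasSum_zetaVal_succ hs).mul_left ((-1) ^ s)) fun k => ?_
  rw [← mul_pow]
  congr 1
  push_cast
  rw [inv_neg, neg_one_mul]

theorem summable_inv_odd_int_pow {s : ℕ} (hs : 2 ≤ s) :
    Summable fun k : ℤ => ((2 * k + 1 : ℝ)⁻¹) ^ s := by
  have h := (summable_inv_int_pow hs).comp_injective (i := fun k : ℤ => 2 * k + 1)
    fun a b h => by simpa using h
  refine h.congr fun k => ?_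
  simp

theorem hasSum_odd_int_inv_pow {s : ℕ} (hs : 2 ≤ s) :
    HasSum (fun k : ℤ => ((2 * k + 1 : ℝ)⁻¹) ^ s) ((1 + (-1) ^ s) * lambdaVal s) := by
  rw [add_mul, one_mul]
  refine HasSum.of_nat_of_neg_add_one (by simpa using hasSum_lambdaVal hs) ?_
  refine hasSum_of_eq ((hasSum_lambdaVal hs).mul_left ((-1) ^ s)) fun k => ?_
  rw [← mul_pow]
  congr 1
  push_cast
  rw [show 2 * (-((k : ℝ) + 1)) + 1 = -(2 * k + 1) by ring, inv_neg, neg_one_mul]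

/-! ### Symmetric partial sums over the integers -/

/-- `φ : ℤ → ℝ` tends to zero at both ends, and its sums over the symmetric windows `[-N, N)` tend
to zero. This is the conditional convergence enjoyed by `k ↦ 1 / k` on the nonzero integers and by
`k ↦ 1 / (2k + 1)`. -/
structure SymmSumZero (φ : ℤ → ℝ) : Prop where
  top : Filter.Tendsto φ Filter.atTop (nhds 0)
  bot : Filter.Tendsto φ Filter.atBot (nhds 0)
  sum : Filter.Tendsto (fun N : ℕ => ∑ k ∈ Finset.Ico (-(N : ℤ)) N, φ k) Filter.atTop (nhds 0)

theorem tendsto_sum_Ico_neg {φ : ℤ → ℝ} {s : ℝ} (h : HasSum φ s) :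
    Filter.Tendsto (fun N : ℕ => ∑ k ∈ Finset.Ico (-(N : ℤ)) N, φ k) Filter.atTop (nhds s) := by
  have h' : Filter.Tendsto (fun t : Finset ℤ => ∑ k ∈ t, φ k) Filter.atTop (nhds s) := by
    simpa [HasSum] using h
  exact h'.comp (Finset.tendsto_Ico_neg (R := ℤ))

theorem sum_Ico_neg_shift (φ : ℤ → ℝ) (N : ℕ) :
    ∑ k ∈ Finset.Ico (-(N : ℤ)) N, φ (k + 1) =
      ∑ k ∈ Finset.Ico (-(N : ℤ)) N, φ k + φ N - φ (-N) := by
  have h := Finset.sum_Ico_int_sub N fun k => φ k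
  rw [Finset.sum_sub_distrib] at h
  linarith

theorem sum_Ico_neg_succ (φ : ℤ → ℝ) (N : ℕ) :
    ∑ k ∈ Finset.Ico (-((N + 1 : ℕ) : ℤ)) (N + 1 : ℕ), φ k =
      ∑ k ∈ Finset.Ico (-(N : ℤ)) N, φ k + φ (-(N + 1)) + φ N := by
  rw [Nat.cast_succ, Finset.Ico_succ_succ, Finset.sum_union (by simp), Finset.sum_pair (by omega),
    add_assoc]

theorem tendsto_neg_natCast_atBot :
    Filter.Tendsto (fun N : ℕ => -(N : ℤ)) Filter.atTop Filter.atBot :=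
  Filter.tendsto_neg_atTop_atBot.comp tendsto_natCast_atTop_atTop

theorem SymmSumZero.shift_one {φ : ℤ → ℝ} (h : SymmSumZero φ) :
    SymmSumZero fun k => φ (k + 1) where
  top := h.top.comp (Filter.tendsto_atTop_add_const_right _ 1 Filter.tendsto_id)
  bot := h.bot.comp (Filter.tendsto_atBot_add_const_right _ 1 Filter.tendsto_id)
  sum := by
    have := (h.sum.add (h.top.comp tendsto_natCast_atTop_atTop)).sub
      (h.bot.comp tendsto_neg_natCast_atBot)
    simp only [add_zero, sub_zero] at this
    refine this.congr fun N => ?_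
    rw [sum_Ico_neg_shift]
    rfl

theorem SymmSumZero.shift_neg_one {φ : ℤ → ℝ} (h : SymmSumZero φ) :
    SymmSumZero fun k => φ (k - 1) where
  top := h.top.comp (Filter.tendsto_atTop_add_const_right _ (-1) Filter.tendsto_id)
  bot := h.bot.comp (Filter.tendsto_atBot_add_const_right _ (-1) Filter.tendsto_id)
  sum := by
    have ht : Filter.Tendsto (fun k : ℤ => φ (k - 1)) Filter.atTop (nhds 0) :=
      h.top.comp (Filter.tendsto_atTop_add_const_right _ (-1) Filter.tendsto_id)
    have hb : Filter.Tendsto (fun k : ℤ => φ (k - 1)) Filter.atBot (nhds 0) :=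
      h.bot.comp (Filter.tendsto_atBot_add_const_right _ (-1) Filter.tendsto_id)
    have := (h.sum.sub (ht.comp tendsto_natCast_atTop_atTop)).add
      (hb.comp tendsto_neg_natCast_atBot)
    simp only [add_zero, sub_zero] at this
    refine this.congr fun N => ?_
    have := sum_Ico_neg_shift (fun k => φ (k - 1)) N
    simp only [add_sub_cancel_right] at this
    rw [this]
    simp only [Function.comp_apply]
    ring

theorem SymmSumZero.shift {φ : ℤ → ℝ} (h : SymmSumZero φ) (d : ℤ) :
    SymmSumZero fun k => φ (k + d) := by
  induction d with
  | zero => simpa using h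
  | succ d ih =>
    have := ih.shift_one
    simpa only [add_assoc, add_comm (1 : ℤ)] using this
  | pred d ih =>
    have := ih.shift_neg_one
    refine (funext fun k => ?_ : (fun k => φ (k + (-(d : ℤ) - 1))) = _) ▸ this
    congr 1
    ring

theorem SymmSumZero.const_mul {φ : ℤ → ℝ} (h : SymmSumZero φ) (c : ℝ) :
    SymmSumZero fun k => c * φ k where
  top := by simpa using h.top.const_mul c
  bot := by simpa using h.bot.const_mul c
  sum := by simpa [← Finset.mul_sum] using h.sum.const_mul c

theorem SymmSumZero.sub {φ ψ : ℤ → ℝ} (h : SymmSumZero φ) (h' : SymmSumZero ψ) :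
    SymmSumZero fun k => φ k - ψ k where
  top := by simpa using h.top.sub h'.top
  bot := by simpa using h.bot.sub h'.bot
  sum := by simpa using h.sum.sub h'.sum

theorem SymmSumZero.hasSum {φ : ℤ → ℝ} (h : SymmSumZero φ) (hs : Summable φ) : HasSum φ 0 := by
  have := tendsto_nhds_unique (tendsto_sum_Ico_neg hs.hasSum) h.sum
  exact this ▸ hs.hasSum

theorem tendsto_inv_intCast_atTop :
    Filter.Tendsto (fun k : ℤ => ((k : ℝ))⁻¹) Filter.atTop (nhds 0) :=
  tendsto_inv_atTop_zero.comp tendsto_intCast_atTop_atTop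

theorem tendsto_inv_intCast_atBot :
    Filter.Tendsto (fun k : ℤ => ((k : ℝ))⁻¹) Filter.atBot (nhds 0) :=
  tendsto_inv_atBot_zero.comp (tendsto_intCast_atBot_iff.2 Filter.tendsto_id)

theorem tendsto_odd_atTop : Filter.Tendsto (fun k : ℤ => 2 * k + 1) Filter.atTop Filter.atTop :=
  Filter.tendsto_atTop_mono' _ (Filter.eventually_ge_atTop 0 |>.mono fun k hk => by
    simp only [id]; omega) Filter.tendsto_id

theorem tendsto_odd_atBot : Filter.Tendsto (fun k : ℤ => 2 * k + 1) Filter.atBot Filter.atBot :=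
  Filter.tendsto_atBot_mono' _ (Filter.eventually_le_atBot (-1) |>.mono fun k hk => by
    simp only [id]; omega) Filter.tendsto_id

theorem symmSumZero_inv : SymmSumZero fun k : ℤ => ((k : ℝ))⁻¹ where
  top := tendsto_inv_intCast_atTop
  bot := tendsto_inv_intCast_atBot
  sum := by
    have : ∀ N : ℕ, ∑ k ∈ Finset.Ico (-(N : ℤ)) N, ((k : ℝ))⁻¹ = -((N : ℝ)⁻¹) := by
      intro N
      induction N with
      | zero => simp
      | succ N ih =>
        rw [sum_Ico_neg_succ, ih]
        push_cast
        rw [inv_neg]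
        ring
    simp only [this]
    simpa using (tendsto_inv_atTop_zero.comp (tendsto_natCast_atTop_atTop (R := ℝ))).neg

theorem symmSumZero_inv_odd : SymmSumZero fun k : ℤ => ((2 * k + 1 : ℝ))⁻¹ where
  top := by
    refine (tendsto_inv_intCast_atTop.comp tendsto_odd_atTop).congr fun k => ?_
    simp
  bot := by
    refine (tendsto_inv_intCast_atBot.comp tendsto_odd_atBot).congr fun k => ?_
    simp
  sum := by
    have : ∀ N : ℕ, ∑ k ∈ Finset.Ico (-(N : ℤ)) N, ((2 * k + 1 : ℝ))⁻¹ = 0 := by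
      intro N
      induction N with
      | zero => simp
      | succ N ih =>
        rw [sum_Ico_neg_succ, ih]
        push_cast
        rw [show 2 * (-((N : ℝ) + 1)) + 1 = -(2 * N + 1) by ring, inv_neg]
        ring
    simp only [this]
    simp

/-! ### Partial fractions over the integers and the odd integers -/

theorem summable_mul_of_sq {ι : Type*} {f g : ι → ℝ} (hf : Summable fun i => f i ^ 2)
    (hg : Summable fun i => g i ^ 2) : Summable fun i => f i * g i := by
  refine (hf.add hg).of_norm_bounded fun i => ?_
  rw [Real.norm_eq_abs, abs_le]
  constructor <;> nlinarith [sq_nonneg (f i + g i), sq_nonneg (f i - g i)]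

theorem summable_inv_sub_int_sq (k : ℤ) : Summable fun j : ℤ => (((k : ℝ) - j)⁻¹) ^ 2 := by
  have h := (summable_inv_int_pow le_rfl).comp_injective (i := fun j : ℤ => k - j)
    fun a b h => by simpa using h
  refine h.congr fun j => ?_
  simp

/-- Partial fractions `k / (j (k - j)) = 1 / j + 1 / (k - j)` and symmetric summation. The terms
`j = 0` and `j = k` vanish by the convention `0⁻¹ = 0`. -/
theorem hasSum_inv_mul_inv_sub {k : ℤ} (hk : k ≠ 0) :
    HasSum (fun j : ℤ => (j : ℝ)⁻¹ * ((k : ℝ) - j)⁻¹) (-2 * ((k : ℝ)⁻¹) ^ 2) := by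
  have hk' : (k : ℝ) ≠ 0 := by exact_mod_cast hk
  have key : ∀ j : ℤ, (j : ℝ)⁻¹ * ((k : ℝ) - j)⁻¹ =
      (k : ℝ)⁻¹ * ((j : ℝ)⁻¹ - (((j + -k : ℤ)) : ℝ)⁻¹) -
        ((if j = 0 then ((k : ℝ)⁻¹) ^ 2 else 0) + if j = k then ((k : ℝ)⁻¹) ^ 2 else 0) := by
    intro j
    rcases eq_or_ne j 0 with rfl | h0
    · simp [hk.symm]; ring
    rcases eq_or_ne j k with rfl | h1
    · simp [hk]; ring
    have h0' : (j : ℝ) ≠ 0 := by exact_mod_cast h0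
    have h1' : (k : ℝ) - j ≠ 0 := by rw [sub_ne_zero]; exact_mod_cast h1.symm
    have h2' : (j : ℝ) - k ≠ 0 := by rw [sub_ne_zero]; exact_mod_cast h1
    rw [if_neg h0, if_neg h1]
    push_cast
    rw [← sub_eq_add_neg, show (j : ℝ) - k = -(k - j) by ring, inv_neg]
    field_simp
    ring
  have hc := (hasSum_ite_eq (0 : ℤ) (((k : ℝ)⁻¹) ^ 2)).add (hasSum_ite_eq k (((k : ℝ)⁻¹) ^ 2))
  have hs := summable_mul_of_sq (summable_inv_int_pow le_rfl) (summable_inv_sub_int_sq k)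
  have hφ := (symmSumZero_inv.sub (symmSumZero_inv.shift (-k))).const_mul ((k : ℝ)⁻¹)
  have := (hφ.hasSum ((hs.add hc.summable).congr fun j => by rw [key]; ring)).sub hc
  rw [show -2 * ((k : ℝ)⁻¹) ^ 2 = 0 - (((k : ℝ)⁻¹) ^ 2 + ((k : ℝ)⁻¹) ^ 2) by ring]
  exact hasSum_of_eq this fun j => (key j).symm

theorem two_mul_intCast_add_one_ne_zero (j : ℤ) : (2 * j + 1 : ℝ) ≠ 0 := by
  have : (2 * j + 1 : ℤ) ≠ 0 := by omega
  exact_mod_cast this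

/-- The analogue of `hasSum_inv_mul_inv_sub` for odd denominators `c = 2j + 1` and `b = 2i + 1`,
with `b - c` replaced by its half. -/
theorem hasSum_inv_odd_mul_inv_sub (i : ℤ) :
    HasSum (fun j : ℤ => (2 * j + 1 : ℝ)⁻¹ * ((i : ℝ) - j)⁻¹) (-2 * ((2 * i + 1 : ℝ)⁻¹) ^ 2) := by
  have hb := two_mul_intCast_add_one_ne_zero i
  have key : ∀ j : ℤ, (2 * j + 1 : ℝ)⁻¹ * ((i : ℝ) - j)⁻¹ =
      (2 * i + 1 : ℝ)⁻¹ * (2 * (2 * j + 1 : ℝ)⁻¹ - (((j + -i : ℤ)) : ℝ)⁻¹) -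
        if j = i then 2 * ((2 * i + 1 : ℝ)⁻¹) ^ 2 else 0 := by
    intro j
    have hc := two_mul_intCast_add_one_ne_zero j
    rcases eq_or_ne j i with rfl | h1
    · simp only [add_neg_cancel, Int.cast_zero, inv_zero, sub_self, mul_zero, if_true]
      ring
    have h1' : (i : ℝ) - j ≠ 0 := by rw [sub_ne_zero]; exact_mod_cast h1.symm
    rw [if_neg h1]
    push_cast
    rw [← sub_eq_add_neg, show (j : ℝ) - i = -(i - j) by ring, inv_neg]
    field_simp
    ring
  have hc := hasSum_ite_eq i (2 * ((2 * i + 1 : ℝ)⁻¹) ^ 2)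
  have hs := summable_mul_of_sq (summable_inv_odd_int_pow le_rfl) (summable_inv_sub_int_sq i)
  have hφ := ((symmSumZero_inv_odd.const_mul 2).sub (symmSumZero_inv.shift (-i))).const_mul
    ((2 * i + 1 : ℝ)⁻¹)
  have := (hφ.hasSum ((hs.add hc.summable).congr fun j => by rw [key]; ring)).sub hc
  rw [show -2 * ((2 * i + 1 : ℝ)⁻¹) ^ 2 = 0 - 2 * ((2 * i + 1 : ℝ)⁻¹) ^ 2 by ring]
  exact hasSum_of_eq this fun j => (key j).symm

/-- The sum `∑ f(2i) t^(n+1-2i)` over `2 ≤ 2i ≤ n` is built up by Horner's scheme. -/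
theorem sum_even_pow_succ (f : ℕ → ℝ) (t : ℝ) (n : ℕ) :
    ∑ i ∈ Finset.Icc 1 ((n + 1) / 2), 2 * f (2 * i) * t ^ (n + 1 + 1 - 2 * i) =
      t * ((1 + (-1) ^ (n + 1)) * f (n + 1) +
        ∑ i ∈ Finset.Icc 1 (n / 2), 2 * f (2 * i) * t ^ (n + 1 - 2 * i)) := by
  have hmul : t * ∑ i ∈ Finset.Icc 1 (n / 2), 2 * f (2 * i) * t ^ (n + 1 - 2 * i) =
      ∑ i ∈ Finset.Icc 1 (n / 2), 2 * f (2 * i) * t ^ (n + 1 + 1 - 2 * i) := by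
    rw [Finset.mul_sum]
    refine Finset.sum_congr rfl fun i hi => ?_
    have := (Finset.mem_Icc.1 hi).2
    rw [show n + 1 + 1 - 2 * i = (n + 1 - 2 * i) + 1 by omega]
    ring
  rw [mul_add, hmul]
  rcases Nat.even_or_odd' n with ⟨q, rfl | rfl⟩
  · rw [show (2 * q + 1) / 2 = 2 * q / 2 by omega]
    simp [pow_succ]
  · rw [show (2 * q + 1 + 1) / 2 = q + 1 by omega, show (2 * q + 1) / 2 = q by omega,
      Finset.sum_Icc_succ_top (by omega)]
    rw [show 2 * q + 1 + 1 + 1 - 2 * (q + 1) = 1 by omega,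
      show 2 * q + 1 + 1 = 2 * (q + 1) by ring, pow_mul]
    norm_num
    ring

/-- `∑_{j ≠ 0, k} 1 / (jᵐ (k - j))` over the integers, the identity behind Euler's formula for
`∑ ζ(2i) ζ(2q - 2i)`. -/
theorem hasSum_inv_pow_mul_inv_sub {k : ℤ} (hk : k ≠ 0) {m : ℕ} (hm : 1 ≤ m) :
    HasSum (fun j : ℤ => ((j : ℝ)⁻¹) ^ m * ((k : ℝ) - j)⁻¹)
      (-(m + 1) * ((k : ℝ)⁻¹) ^ (m + 1) +
        ∑ i ∈ Finset.Icc 1 (m / 2), 2 * zetaVal (2 * i) * ((k : ℝ)⁻¹) ^ (m + 1 - 2 * i)) := by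
  have hk' : (k : ℝ) ≠ 0 := by exact_mod_cast hk
  induction m, hm using Nat.le_induction with
  | base => simpa [show (1 + 1 : ℝ) = 2 by norm_num] using hasSum_inv_mul_inv_sub hk
  | succ m hm ih =>
    have h := (((hasSum_int_inv_pow (s := m + 1) (by omega)).add ih).mul_left ((k : ℝ)⁻¹)).sub
      (hasSum_ite_eq k (((k : ℝ)⁻¹) ^ (m + 2)))
    rw [sum_even_pow_succ]
    refine hasSum_of_eq_of_eq h (fun j => ?_) ?_
    · rcases eq_or_ne j k with rfl | h1
      · simp only [sub_self, inv_zero, mul_zero, if_true]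
        ring
      rcases eq_or_ne j 0 with rfl | h0
      · simp [h1, show m ≠ 0 by omega]
      have h0' : (j : ℝ) ≠ 0 := by exact_mod_cast h0
      have h1' : (k : ℝ) - j ≠ 0 := by rw [sub_ne_zero]; exact_mod_cast h1.symm
      rw [if_neg h1, pow_succ]
      field_simp
      ring
    · push_cast; ring

/-- `2 ∑_{c ≠ b} 1 / (cⁿ (b - c))` over the odd integers `c = 2j + 1`, where `b = 2i + 1`. -/
theorem hasSum_inv_odd_pow_mul_inv_sub (i : ℤ) {n : ℕ} (hn : 1 ≤ n) :
    HasSum (fun j : ℤ => ((2 * j + 1 : ℝ)⁻¹) ^ n * ((i : ℝ) - j)⁻¹)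
      (2 * (-n * ((2 * i + 1 : ℝ)⁻¹) ^ (n + 1) +
        ∑ l ∈ Finset.Icc 1 (n / 2),
          2 * lambdaVal (2 * l) * ((2 * i + 1 : ℝ)⁻¹) ^ (n + 1 - 2 * l))) := by
  have hb := two_mul_intCast_add_one_ne_zero i
  induction n, hn using Nat.le_induction with
  | base =>
    have := hasSum_inv_odd_mul_inv_sub i
    simpa using this
  | succ n hn ih =>
    have h := ((((hasSum_odd_int_inv_pow (s := n + 1) (by omega)).mul_left 2).add ih).mul_left
      ((2 * i + 1 : ℝ)⁻¹)).sub (hasSum_ite_eq i (2 * ((2 * i + 1 : ℝ)⁻¹) ^ (n + 2)))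
    rw [sum_even_pow_succ]
    refine hasSum_of_eq_of_eq h (fun j => ?_) ?_
    · rcases eq_or_ne j i with rfl | h1
      · simp only [sub_self, inv_zero, mul_zero, if_true]
        ring
      have h0' := two_mul_intCast_add_one_ne_zero j
      have h1' : (i : ℝ) - j ≠ 0 := by rw [sub_ne_zero]; exact_mod_cast h1.symm
      rw [if_neg h1, pow_succ]
      field_simp
      ring
    · push_cast; ring

/-! ### Summability over pairs of integers -/

theorem summable_sqrt_inv_abs_pow_three :
    Summable fun x : ℤ => √|(x : ℝ)⁻¹| ^ 3 := by
  have h := Real.summable_abs_int_rpow (b := 3 / 2) (by norm_num)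
  refine h.congr fun x => ?_
  rw [abs_inv, Real.sqrt_inv, inv_pow, Real.rpow_neg (abs_nonneg _), Real.sqrt_eq_rpow,
    ← Real.rpow_natCast, ← Real.rpow_mul (abs_nonneg _)]
  norm_num

/-- By the inequality of arithmetic and geometric means, `1 / |x y (x + y)|` is at most
`|x y|^(-3/2) + |x (x + y)|^(-3/2) + |y (x + y)|^(-3/2)`. -/
theorem summable_inv_mul_inv_mul_inv_add :
    Summable fun p : ℤ × ℤ => ((p.1 : ℝ))⁻¹ * ((p.2 : ℝ))⁻¹ * ((p.1 + p.2 : ℝ))⁻¹ := by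
  set w : ℤ → ℝ := fun x => √|(x : ℝ)⁻¹| with hw
  have hw0 : ∀ x, 0 ≤ w x := fun x => Real.sqrt_nonneg _
  have hP : Summable fun p : ℤ × ℤ => w p.1 ^ 3 * w p.2 ^ 3 :=
    summable_sqrt_inv_abs_pow_three.mul_of_nonneg summable_sqrt_inv_abs_pow_three
      (fun x => pow_nonneg (hw0 x) 3) (fun x => pow_nonneg (hw0 x) 3)
  have hQ : Summable fun p : ℤ × ℤ => w p.1 ^ 3 * w (p.1 + p.2) ^ 3 :=
    hP.comp_injective (i := fun p : ℤ × ℤ => (p.1, p.1 + p.2)) fun p q h => by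
      simp only [Prod.mk.injEq] at h
      exact Prod.ext h.1 (by omega)
  have hR : Summable fun p : ℤ × ℤ => w p.2 ^ 3 * w (p.1 + p.2) ^ 3 :=
    hP.comp_injective (i := fun p : ℤ × ℤ => (p.2, p.1 + p.2)) fun p q h => by
      simp only [Prod.mk.injEq] at h
      exact Prod.ext (by omega) h.1
  refine ((hP.add hQ).add hR).of_norm_bounded fun p => ?_
  have e : ∀ x : ℤ, |(x : ℝ)⁻¹| = w x ^ 2 := fun x => (Real.sq_sqrt (abs_nonneg _)).symm
  rw [norm_mul, norm_mul, Real.norm_eq_abs, Real.norm_eq_abs, Real.norm_eq_abs, e, e,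
    ← Int.cast_add, e]
  have key : ∀ X Y Z : ℝ, 0 ≤ X → 0 ≤ Y → 0 ≤ Z → X * Y * Z ≤ X ^ 3 + Y ^ 3 + Z ^ 3 := by
    intro X Y Z hX hY hZ
    nlinarith [mul_nonneg (add_nonneg (add_nonneg hX hY) hZ)
      (add_nonneg (add_nonneg (sq_nonneg (X - Y)) (sq_nonneg (Y - Z))) (sq_nonneg (X - Z))),
      mul_nonneg (mul_nonneg hX hY) hZ]
  have := key (w p.1 * w p.2) (w p.1 * w (p.1 + p.2)) (w p.2 * w (p.1 + p.2))
    (mul_nonneg (hw0 _) (hw0 _)) (mul_nonneg (hw0 _) (hw0 _)) (mul_nonneg (hw0 _) (hw0 _))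
  simp only [mul_pow] at this
  linarith

theorem abs_inv_intCast_le_one (x : ℤ) : |(x : ℝ)⁻¹| ≤ 1 := by
  rcases eq_or_ne x 0 with rfl | h
  · simp
  · rw [abs_inv]
    exact inv_le_one_of_one_le₀ (by exact_mod_cast Int.one_le_abs h)

theorem abs_pow_sub_pow_le {s t : ℝ} (hs : |s| ≤ 1) (ht : |t| ≤ 1) (n : ℕ) :
    |s ^ n - t ^ n| ≤ n * |s - t| := by
  induction n with
  | zero => simp
  | succ n ih =>
    have e : s ^ (n + 1) - t ^ (n + 1) = (s ^ n - t ^ n) * s + t ^ n * (s - t) := by ring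
    rw [e]
    refine (abs_add_le _ _).trans ?_
    rw [abs_mul, abs_mul, abs_pow]
    have h1 := mul_le_mul ih hs (abs_nonneg s) (by positivity)
    have h2 := mul_le_mul_of_nonneg_right (pow_le_one₀ (n := n) (abs_nonneg t) ht)
      (abs_nonneg (s - t))
    push_cast
    linarith

/-- The term `(1 / xⁿ - 1 / (x + y)ⁿ) / yᵐ` for a pair of integers. Summed over `x` in a half-line
it gives harmonic numbers divided by `yᵐ`. -/
noncomputable def eulerTerm (n m : ℕ) (x y : ℤ) : ℝ :=
  ((y : ℝ)⁻¹) ^ m * (((x : ℝ)⁻¹) ^ n - ((x + y : ℝ)⁻¹) ^ n)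

/-- Off the lines `x = 0` and `x + y = 0`, the term is at most `n / |x y (x + y)|`; on these lines
it is at most `n / |y|³`. -/
theorem summable_eulerTerm (n : ℕ) {m : ℕ} (hm : 2 ≤ m) :
    Summable fun p : ℤ × ℤ => eulerTerm n m p.1 p.2 := by
  set v : ℤ → ℝ := fun y => |(y : ℝ)⁻¹| with hv
  have hv0 : ∀ y, 0 ≤ v y := fun y => abs_nonneg _
  have hv1 : ∀ y, v y ≤ 1 := abs_inv_intCast_le_one
  set δ : ℤ → ℝ := fun x => if x = 0 then 1 else 0 with hδ
  have hδ0 : ∀ x, 0 ≤ δ x := fun x => by simp only [hδ]; split_ifs <;> norm_num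
  have hv3 : Summable fun y => v y ^ 3 := by
    simpa [hv, ← abs_pow] using (summable_inv_int_pow (s := 3) (by norm_num)).abs
  have hP : Summable fun p : ℤ × ℤ => δ p.1 * v p.2 ^ 3 :=
    (hasSum_ite_eq (0 : ℤ) (1 : ℝ)).summable.mul_of_nonneg hv3 hδ0 fun y => pow_nonneg (hv0 y) 3
  have hQ : Summable fun p : ℤ × ℤ => δ (p.1 + p.2) * v p.2 ^ 3 :=
    hP.comp_injective (i := fun p : ℤ × ℤ => (p.1 + p.2, p.2)) fun p q h => by
      simp only [Prod.mk.injEq] at h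
      exact Prod.ext (by omega) h.2
  have hT := summable_inv_mul_inv_mul_inv_add.abs
  refine (((hT.add hP).add hQ).mul_left (n : ℝ)).of_norm_bounded fun p => ?_
  obtain ⟨x, y⟩ := p
  simp only [Real.norm_eq_abs, eulerTerm]
  rw [abs_mul, abs_pow]
  have h1 : |((x : ℝ)⁻¹) ^ n - ((x + y : ℝ)⁻¹) ^ n| ≤ n * |(x : ℝ)⁻¹ - (x + y : ℝ)⁻¹| := by
    refine abs_pow_sub_pow_le (hv1 x) ?_ n
    have := hv1 (x + y)
    simpa [hv] using this
  have h2 : |(y : ℝ)⁻¹| ^ m ≤ v y ^ 2 := pow_le_pow_of_le_one (hv0 y) (hv1 y) hm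
  refine (mul_le_mul h2 h1 (abs_nonneg _) (sq_nonneg _)).trans ?_
  rw [mul_left_comm]
  refine mul_le_mul_of_nonneg_left ?_ (Nat.cast_nonneg n)
  have t0 : 0 ≤ |(x : ℝ)⁻¹ * (y : ℝ)⁻¹ * (x + y : ℝ)⁻¹| := abs_nonneg _
  have d1 : 0 ≤ δ x * v y ^ 3 := mul_nonneg (hδ0 _) (pow_nonneg (hv0 y) 3)
  have d2 : 0 ≤ δ (x + y) * v y ^ 3 := mul_nonneg (hδ0 _) (pow_nonneg (hv0 y) 3)
  rcases eq_or_ne y 0 with rfl | hy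
  · simp [hv]
  rcases eq_or_ne x 0 with rfl | hx
  · have : v y ^ 2 * |((0 : ℤ) : ℝ)⁻¹ - (((0 : ℤ) : ℝ) + y)⁻¹| = δ 0 * v y ^ 3 := by
      rw [pow_succ (v y) 2]
      simp [hv, hδ, abs_inv]
    linarith
  rcases eq_or_ne (x + y) 0 with hxy | hxy
  · have hx' : (x : ℝ) = -y := by
      have : x = -y := by omega
      rw [this]; push_cast; rfl
    have : v y ^ 2 * |(x : ℝ)⁻¹ - (x + y : ℝ)⁻¹| = δ (x + y) * v y ^ 3 := by
      rw [hxy, hx', pow_succ (v y) 2]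
      simp [hv, hδ, abs_inv]
    linarith
  · have hx' : (x : ℝ) ≠ 0 := by exact_mod_cast hx
    have hy' : (y : ℝ) ≠ 0 := by exact_mod_cast hy
    have hxy' : (x + y : ℝ) ≠ 0 := by exact_mod_cast hxy
    have : v y ^ 2 * |(x : ℝ)⁻¹ - (x + y : ℝ)⁻¹| =
        |(x : ℝ)⁻¹ * (y : ℝ)⁻¹ * (x + y : ℝ)⁻¹| := by
      simp only [hv]
      rw [← abs_pow, ← abs_mul]
      congr 1
      field_simp
      ring
    linarith

/-- For bounded `u`, the kernel `u_j / (kᵐ j (k - j))` is summable over pairs `(j, k)`. -/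
theorem summable_recursionKernel (u : ℤ → ℝ) {C : ℝ} (hu : ∀ j, |u j| ≤ C) {m : ℕ} (hm : 1 ≤ m) :
    Summable fun p : ℤ × ℤ =>
      u p.1 * ((p.2 : ℝ)⁻¹) ^ m * (p.1 : ℝ)⁻¹ * ((p.2 - p.1 : ℝ))⁻¹ := by
  have h := summable_inv_mul_inv_mul_inv_add.comp_injective
    (i := fun p : ℤ × ℤ => (p.1, p.2 - p.1)) fun p q h => by
      simp only [Prod.mk.injEq] at h
      exact Prod.ext h.1 (by omega)
  refine (h.abs.mul_left C).of_norm_bounded fun p => ?_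
  obtain ⟨j, k⟩ := p
  simp only [Function.comp_apply, Real.norm_eq_abs]
  push_cast
  rw [add_sub_cancel]
  have h1 : |(k : ℝ)⁻¹| ^ m ≤ |(k : ℝ)⁻¹| :=
    pow_le_of_le_one (abs_nonneg _) (abs_inv_intCast_le_one k) (by omega)
  simp only [abs_mul, abs_pow]
  have hC := (abs_nonneg (u 0)).trans (hu 0)
  calc |u j| * |(k : ℝ)⁻¹| ^ m * |(j : ℝ)⁻¹| * |((k : ℝ) - j)⁻¹|
      ≤ C * |(k : ℝ)⁻¹| * |(j : ℝ)⁻¹| * |((k : ℝ) - j)⁻¹| := by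
        gcongr
        exact hu j
    _ = _ := by ring

/-! ### The recursion for a fixed odd number -/

/-- `1 / aⁿ - 1 / (a + 2k)ⁿ` for the odd number `a = 2r + 1`. -/
noncomputable def oddDiff (r : ℤ) (n : ℕ) (k : ℤ) : ℝ :=
  ((2 * r + 1 : ℝ)⁻¹) ^ n - ((2 * (r + k) + 1 : ℝ)⁻¹) ^ n

/-- `∑_{k ≠ 0} (1 / aⁿ - 1 / (a + 2k)ⁿ) / kᵐ` over the nonzero integers, for the odd number
`a = 2r + 1`. Summed over all odd `a > 0` this gives `2 T¹_{n,m}` in odd weight. -/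
noncomputable def oddU (r : ℤ) (n m : ℕ) : ℝ := ∑' k : ℤ, ((k : ℝ)⁻¹) ^ m * oddDiff r n k

theorem abs_inv_odd_le_one (r : ℤ) : |(2 * r + 1 : ℝ)⁻¹| ≤ 1 := by
  simpa using abs_inv_intCast_le_one (2 * r + 1)

theorem abs_oddDiff_le (r : ℤ) (n : ℕ) (k : ℤ) : |oddDiff r n k| ≤ 2 := by
  have h1 := pow_le_one₀ (n := n) (abs_nonneg _) (abs_inv_odd_le_one r)
  have h2 := pow_le_one₀ (n := n) (abs_nonneg _) (abs_inv_odd_le_one (r + k))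
  push_cast at h2
  rw [← abs_pow] at h1 h2
  refine (abs_sub _ _).trans ?_
  linarith

theorem hasSum_oddU (r : ℤ) (n : ℕ) {m : ℕ} (hm : 2 ≤ m) :
    HasSum (fun k : ℤ => ((k : ℝ)⁻¹) ^ m * oddDiff r n k) (oddU r n m) := by
  refine Summable.hasSum ?_
  refine ((summable_inv_int_pow hm).abs.mul_right 2).of_norm_bounded fun k => ?_
  rw [Real.norm_eq_abs, abs_mul]
  exact mul_le_mul_of_nonneg_left (abs_oddDiff_le r n k) (abs_nonneg _)

/-- `∑_{c ≠ b} 1 / (cⁿ (b - c))` over odd `c`, for `b = 2i + 1`; see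
`hasSum_inv_odd_pow_mul_inv_sub`. -/
noncomputable def oddG (n : ℕ) (i : ℤ) : ℝ :=
  -n * ((2 * i + 1 : ℝ)⁻¹) ^ (n + 1) +
    ∑ l ∈ Finset.Icc 1 (n / 2), 2 * lambdaVal (2 * l) * ((2 * i + 1 : ℝ)⁻¹) ^ (n + 1 - 2 * l)

theorem hasSum_oddG_shift (r : ℤ) {n : ℕ} (hn : 1 ≤ n) (k : ℤ) :
    HasSum (fun j : ℤ => ((2 * (r + j) + 1 : ℝ)⁻¹) ^ n * ((k : ℝ) - j)⁻¹)
      (2 * oddG n (r + k)) := by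
  have h := (Equiv.hasSum_iff (Equiv.addLeft r)).2 (hasSum_inv_odd_pow_mul_inv_sub (r + k) hn)
  refine hasSum_of_eq_of_eq h (fun j => ?_) ?_
  · simp
  · simp [oddG]

/-- Summation of the recursion kernel over its first index. -/
theorem hasSum_oddDiff_mul (r : ℤ) {n : ℕ} (hn : 1 ≤ n) {m : ℕ} (hm : 1 ≤ m) (k : ℤ) :
    HasSum (fun j : ℤ => oddDiff r n j * ((k : ℝ)⁻¹) ^ m * (j : ℝ)⁻¹ * ((k - j : ℝ))⁻¹)
      (((k : ℝ)⁻¹) ^ (m + 1) * (2 * (oddG n r - oddG n (r + k)) - oddDiff r n k * (k : ℝ)⁻¹)) := by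
  rcases eq_or_ne k 0 with rfl | hk
  · simp [show m ≠ 0 by omega, hasSum_zero]
  have hk' : (k : ℝ) ≠ 0 := by exact_mod_cast hk
  set α : ℝ := ((2 * r + 1 : ℝ)⁻¹) ^ n with hα
  set β : ℝ := ((2 * (r + k) + 1 : ℝ)⁻¹) ^ n with hβ
  have h0 := hasSum_oddG_shift r hn 0
  have h := (((((h0.sub (hasSum_oddG_shift r hn k)).add
    ((hasSum_inv_mul_inv_sub hk).mul_left (α * k))).add
    (hasSum_ite_eq (0 : ℤ) (α * (k : ℝ)⁻¹))).add
    (hasSum_ite_eq k (β * (k : ℝ)⁻¹)))).mul_left (((k : ℝ)⁻¹) ^ (m + 1))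
  refine hasSum_of_eq_of_eq h (fun j => ?_) ?_
  · rcases eq_or_ne j 0 with rfl | hj
    · simp [hk.symm, oddDiff, ← hα]
    rcases eq_or_ne j k with rfl | hjk
    · simp [hk, ← hβ]
    have h0' : (j : ℝ) ≠ 0 := by exact_mod_cast hj
    have h1' : (k : ℝ) - j ≠ 0 := by rw [sub_ne_zero]; exact_mod_cast hjk.symm
    simp only [if_neg hj, if_neg hjk, oddDiff, ← hα, Int.cast_zero, zero_sub, inv_neg]
    generalize ((2 * ((r : ℝ) + j) + 1)⁻¹) ^ n = γ
    rw [pow_succ]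
    field_simp
    ring
  · simp only [add_zero, oddDiff, ← hα, ← hβ]
    rw [pow_succ]
    field_simp
    ring

/-- Summation of the recursion kernel over its second index. -/
theorem hasSum_oddDiff_mul' (r : ℤ) (n : ℕ) {m : ℕ} (hm : 1 ≤ m) (j : ℤ) :
    HasSum (fun k : ℤ => oddDiff r n j * ((k : ℝ)⁻¹) ^ m * (j : ℝ)⁻¹ * ((k - j : ℝ))⁻¹)
      ((m + 1) * (((j : ℝ)⁻¹) ^ (m + 2) * oddDiff r n j) -
        ∑ i ∈ Finset.Icc 1 (m / 2),
          2 * zetaVal (2 * i) * (((j : ℝ)⁻¹) ^ (m + 2 - 2 * i) * oddDiff r n j)) := by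
  rcases eq_or_ne j 0 with rfl | hj
  · simp [oddDiff, hasSum_zero]
  have h := (hasSum_inv_pow_mul_inv_sub hj hm).mul_left (-(oddDiff r n j * (j : ℝ)⁻¹))
  refine hasSum_of_eq_of_eq h (fun k => ?_) ?_
  · rw [show (k : ℝ) - j = -(j - k) by ring, inv_neg]
    ring
  · rw [mul_add, sub_eq_add_neg, ← Finset.sum_neg_distrib, Finset.mul_sum]
    congr 1
    · ring
    · refine Finset.sum_congr rfl fun i hi => ?_
      have := (Finset.mem_Icc.1 hi).2
      rw [show m + 2 - 2 * i = (m + 1 - 2 * i) + 1 by omega]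
      ring

theorem hasSum_oddG_sub (r : ℤ) (n : ℕ) {m : ℕ} (hm : 2 ≤ m) :
    HasSum
      (fun k : ℤ => ((k : ℝ)⁻¹) ^ m *
        (2 * (oddG n r - oddG n (r + k)) - oddDiff r n k * (k : ℝ)⁻¹))
      (2 * (-n * oddU r (n + 1) m +
        ∑ l ∈ Finset.Icc 1 (n / 2), 2 * lambdaVal (2 * l) * oddU r (n + 1 - 2 * l) m) -
        oddU r n (m + 1)) := by
  have h1 := (hasSum_oddU r (n + 1) hm).mul_left (-(n : ℝ))
  have h2 : HasSum (fun k : ℤ => ∑ l ∈ Finset.Icc 1 (n / 2),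
      2 * lambdaVal (2 * l) * (((k : ℝ)⁻¹) ^ m * oddDiff r (n + 1 - 2 * l) k))
      (∑ l ∈ Finset.Icc 1 (n / 2), 2 * lambdaVal (2 * l) * oddU r (n + 1 - 2 * l) m) :=
    hasSum_sum fun l _ => (hasSum_oddU r (n + 1 - 2 * l) hm).mul_left (2 * lambdaVal (2 * l))
  have h3 := ((h1.add h2).mul_left 2).sub (hasSum_oddU r n (m := m + 1) (by omega))
  refine hasSum_of_eq h3 fun k => ?_
  have e : ((k : ℝ)⁻¹) ^ m * (oddG n r - oddG n (r + k)) =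
      -n * (((k : ℝ)⁻¹) ^ m * oddDiff r (n + 1) k) +
      ∑ l ∈ Finset.Icc 1 (n / 2),
        2 * lambdaVal (2 * l) * (((k : ℝ)⁻¹) ^ m * oddDiff r (n + 1 - 2 * l) k) := by
    simp only [mul_left_comm _ (((k : ℝ)⁻¹) ^ m), ← Finset.mul_sum, ← mul_add]
    simp only [oddG, oddDiff, mul_sub, Finset.sum_sub_distrib]
    push_cast
    ring
  rw [pow_succ]
  linear_combination (-2) * e

theorem hasSum_oddDiff_zeta (r : ℤ) (n : ℕ) {m : ℕ} (hm : 1 ≤ m) :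
    HasSum
      (fun j : ℤ => (m + 1) * (((j : ℝ)⁻¹) ^ (m + 2) * oddDiff r n j) -
        ∑ i ∈ Finset.Icc 1 (m / 2),
          2 * zetaVal (2 * i) * (((j : ℝ)⁻¹) ^ (m + 2 - 2 * i) * oddDiff r n j))
      ((m + 1) * oddU r n (m + 2) -
        ∑ i ∈ Finset.Icc 1 (m / 2), 2 * zetaVal (2 * i) * oddU r n (m + 2 - 2 * i)) := by
  refine ((hasSum_oddU r n (by omega)).mul_left _).sub (hasSum_sum fun i hi => ?_)
  have := (Finset.mem_Icc.1 hi).2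
  exact (hasSum_oddU r n (by omega)).mul_left _

/-- The recursion satisfied by the sums `oddU`, in any weight. Both sides arise by summing the
kernel `(1 / aⁿ - 1 / (a + 2j)ⁿ) / (kᵐ⁻¹ j (k - j))` over `j` and `k`, in the two orders. -/
theorem oddU_recursion (r : ℤ) {n m : ℕ} (hn : 1 ≤ n) (hm : 2 ≤ m) :
    (n : ℝ) * oddU r (n + 1) m =
      2 * ∑ i ∈ Finset.Icc 1 (n / 2), lambdaVal (2 * i) * oddU r (n + 1 - 2 * i) m
      + ∑ i ∈ Finset.Icc 1 ((m - 1) / 2), zetaVal (2 * i) * oddU r n (m + 1 - 2 * i)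
      - ((m : ℝ) + 1) / 2 * oddU r n (m + 1) := by
  obtain ⟨m, rfl⟩ : ∃ l, m = l + 1 := ⟨m - 1, by omega⟩
  have hm1 : 1 ≤ m := by omega
  have hsum := summable_recursionKernel (oddDiff r n) (abs_oddDiff_le r n) hm1
  have hcomm : ∑' k : ℤ, ∑' j : ℤ,
        oddDiff r n j * ((k : ℝ)⁻¹) ^ m * (j : ℝ)⁻¹ * ((k - j : ℝ))⁻¹ =
      ∑' j : ℤ, ∑' k : ℤ, oddDiff r n j * ((k : ℝ)⁻¹) ^ m * (j : ℝ)⁻¹ * ((k - j : ℝ))⁻¹ :=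
    Summable.tsum_comm (f := fun j k : ℤ =>
      oddDiff r n j * ((k : ℝ)⁻¹) ^ m * (j : ℝ)⁻¹ * ((k - j : ℝ))⁻¹) hsum
  rw [tsum_congr fun k => (hasSum_oddDiff_mul r hn hm1 k).tsum_eq,
    tsum_congr fun j => (hasSum_oddDiff_mul' r n hm1 j).tsum_eq,
    (hasSum_oddG_sub r n hm).tsum_eq, (hasSum_oddDiff_zeta r n hm1).tsum_eq] at hcomm
  simp only [mul_assoc, ← Finset.mul_sum] at hcomm
  rw [Nat.add_sub_cancel]
  push_cast
  rw [show m + 1 + 1 = m + 2 by ring]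
  linarith

/-! ### Convergence of the series -/

theorem sum_range_inv_le_two_mul_sqrt (k : ℕ) :
    ∑ i ∈ Finset.range k, (i + 1 : ℝ)⁻¹ ≤ 2 * √k := by
  induction k with
  | zero => simp
  | succ k ih =>
    rw [Finset.sum_range_succ]
    have h1 : (0 : ℝ) < √(k + 1) := Real.sqrt_pos.2 (by positivity)
    have h0 : 0 ≤ √(k : ℝ) := Real.sqrt_nonneg _
    have e1 : √(k + 1 : ℝ) ^ 2 = k + 1 := Real.sq_sqrt (by positivity)
    have e0 : √(k : ℝ) ^ 2 = k := Real.sq_sqrt (by positivity)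
    have h01 : √(k : ℝ) ≤ √(k + 1) := Real.sqrt_le_sqrt (by linarith)
    have key : (k + 1 : ℝ)⁻¹ ≤ 2 * (√(k + 1) - √k) := by
      have hge : (1 : ℝ) ≤ √(k + 1) :=
        Real.one_le_sqrt.2 (by linarith [(Nat.cast_nonneg k : (0 : ℝ) ≤ k)])
      -- the difference of the square roots is the reciprocal of their sum
      have hd : (√(k + 1 : ℝ) - √k) * (√(k + 1) + √k) = 1 := by nlinarith
      have hd0 : 0 ≤ √(k + 1 : ℝ) - √k := by linarith
      have h2 : 1 ≤ 2 * (√(k + 1 : ℝ) - √k) * √(k + 1) := by nlinarith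
      rw [inv_le_iff_one_le_mul₀ (by positivity)]
      calc (1 : ℝ) ≤ 2 * (√(k + 1 : ℝ) - √k) * √(k + 1) := h2
        _ ≤ 2 * (√(k + 1 : ℝ) - √k) * √(k + 1) * √(k + 1) :=
          le_mul_of_one_le_right (by positivity) hge
        _ = 2 * (√(k + 1 : ℝ) - √k) * √(k + 1) ^ 2 := by ring
        _ = 2 * (√(k + 1 : ℝ) - √k) * (k + 1) := by rw [e1]
    push_cast
    linarith

theorem harm_nonneg (n k : ℕ) : 0 ≤ harm n k := by
  rw [harm_eq_sum_range]
  positivity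

theorem oddHarm_nonneg (n k : ℕ) : 0 ≤ oddHarm n k := by
  rw [oddHarm_eq_sum_range]
  positivity

theorem harm_le {n : ℕ} (hn : 1 ≤ n) (k : ℕ) : harm n k ≤ 2 * √k := by
  rw [harm_eq_sum_range]
  refine (Finset.sum_le_sum fun i _ => ?_).trans (sum_range_inv_le_two_mul_sqrt k)
  exact pow_le_of_le_one (by positivity)
    (inv_le_one_of_one_le₀ (by linarith [(Nat.cast_nonneg i : (0 : ℝ) ≤ i)])) (by omega)

theorem oddHarm_le_harm (n k : ℕ) : oddHarm n k ≤ harm n k := by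
  rw [harm_eq_sum_range, oddHarm_eq_sum_range]
  refine Finset.sum_le_sum fun i _ => ?_
  gcongr
  linarith [(Nat.cast_nonneg i : (0 : ℝ) ≤ i)]

theorem summable_mul_of_le_sqrt {A B : ℕ → ℝ} (hA0 : ∀ k, 0 ≤ A k) (hA : ∀ k, A k ≤ 2 * √k)
    (hB0 : ∀ k, 0 ≤ B k) (hB : ∀ k : ℕ, B k ≤ ((k : ℝ)⁻¹) ^ 2) : Summable fun k => A k * B k := by
  have h := (Real.summable_nat_rpow_inv (p := 3 / 2)).2 (by norm_num)
  refine (h.mul_left 2).of_norm_bounded fun k => ?_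
  rw [Real.norm_eq_abs, abs_of_nonneg (mul_nonneg (hA0 k) (hB0 k))]
  refine (mul_le_mul (hA k) (hB k) (hB0 k) (by positivity)).trans (le_of_eq ?_)
  rcases Nat.eq_zero_or_pos k with rfl | hk
  · simp
  have hk' : (0 : ℝ) < k := by exact_mod_cast hk
  rw [mul_assoc]
  congr 1
  rw [← Real.rpow_neg hk'.le, Real.sqrt_eq_rpow, ← Real.rpow_natCast, ← Real.rpow_neg_one,
    ← Real.rpow_mul hk'.le, ← Real.rpow_add hk']
  norm_num

theorem inv_two_mul_sub_one_pow_le {m : ℕ} (hm : 2 ≤ m) (k : ℕ) :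
    ((2 * ((k + 1 : ℕ) : ℝ) - 1)⁻¹) ^ m ≤ (((k + 1 : ℕ) : ℝ)⁻¹) ^ 2 := by
  have hk : (0 : ℝ) ≤ k := Nat.cast_nonneg k
  push_cast
  have h1 : (k + 1 : ℝ) ≤ 2 * (k + 1) - 1 := by linarith
  refine (pow_le_pow_of_le_one (inv_nonneg.2 (by linarith))
    (inv_le_one_of_one_le₀ (by linarith)) hm).trans ?_
  exact pow_le_pow_left₀ (inv_nonneg.2 (by linarith)) (inv_anti₀ (by positivity) h1) 2

theorem inv_pow_le_inv_sq {m : ℕ} (hm : 2 ≤ m) (k : ℕ) :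
    ((k : ℝ)⁻¹) ^ m ≤ ((k : ℝ)⁻¹) ^ 2 :=
  pow_le_pow_of_le_one (by positivity) (Nat.cast_inv_le_one k) hm

theorem converges_div_pow {A : ℕ → ℝ} (hA0 : ∀ k, 0 ≤ A k) (hA : ∀ k, A k ≤ 2 * √k) {m : ℕ}
    (hm : 2 ≤ m) : Converges fun k => A k / (k : ℝ) ^ m := by
  refine (summable_nat_add_iff (f := fun k : ℕ => A k / (k : ℝ) ^ m) 1).2 ?_
  simp only [div_eq_mul_inv, ← inv_pow]
  exact summable_mul_of_le_sqrt hA0 hA (fun k => by positivity) (inv_pow_le_inv_sq hm)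

theorem converges_div_odd_pow {A : ℕ → ℝ} (hA0 : ∀ k, 0 ≤ A k) (hA : ∀ k, A k ≤ 2 * √k) {m : ℕ}
    (hm : 2 ≤ m) : Converges fun k => A k / (2 * (k : ℝ) - 1) ^ m := by
  have h := (summable_nat_add_iff 1).2
    (summable_mul_of_le_sqrt hA0 hA (fun k => by positivity) fun k => le_refl (((k : ℝ)⁻¹) ^ 2))
  refine h.of_nonneg_of_le (fun k => ?_) fun k => ?_
  · have hk : (0 : ℝ) ≤ k := Nat.cast_nonneg k
    push_cast
    exact div_nonneg (hA0 _) (pow_nonneg (by linarith) m)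
  · simp only [div_eq_mul_inv, ← inv_pow]
    exact mul_le_mul_of_nonneg_left (inv_two_mul_sub_one_pow_le hm k) (hA0 _)

theorem converges_termS {n m : ℕ} (hn : 1 ≤ n) (hm : 2 ≤ m) : Converges (termS n m) :=
  converges_div_pow (harm_nonneg n) (harm_le hn) hm

theorem converges_term1 {n m : ℕ} (hn : 1 ≤ n) (hm : 2 ≤ m) : Converges (term1 n m) :=
  converges_div_pow (oddHarm_nonneg n) (fun k => (oddHarm_le_harm n k).trans (harm_le hn k)) hm

theorem converges_term3 {n m : ℕ} (hn : 1 ≤ n) (hm : 2 ≤ m) : Converges (term3 n m) :=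
  converges_div_odd_pow (oddHarm_nonneg n) (fun k => (oddHarm_le_harm n k).trans (harm_le hn k)) hm

theorem converges_term6 {n m : ℕ} (hn : 1 ≤ n) (hm : 2 ≤ m) : Converges (term6 n m) :=
  converges_div_odd_pow (harm_nonneg n) (harm_le hn) hm

theorem converges_termD {n m : ℕ} (hnm : 2 ≤ n + m) : Converges (termD n m) := by
  have h := (summable_nat_add_iff 1).2 (summable_inv_nat_pow (s := 2) le_rfl)
  refine h.of_nonneg_of_le (fun k => ?_) fun k => ?_
  · have hk : (0 : ℝ) ≤ k := Nat.cast_nonneg k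
    rw [termD]
    push_cast
    exact div_nonneg zero_le_one (mul_nonneg (by positivity) (pow_nonneg (by linarith) m))
  · have hk : (0 : ℝ) ≤ k := Nat.cast_nonneg k
    rw [termD, one_div, inv_pow]
    push_cast
    have h1 : (k + 1 : ℝ) ^ 2 ≤ (k + 1) ^ (n + m) := pow_le_pow_right₀ (by linarith) hnm
    have h2 : (k + 1 : ℝ) ^ m ≤ (2 * (k + 1) - 1) ^ m :=
      pow_le_pow_left₀ (by linarith) (by linarith) m
    refine inv_anti₀ (by positivity) (h1.trans ?_)
    rw [pow_add]
    exact mul_le_mul_of_nonneg_left h2 (by positivity)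

theorem Converges.hasSum_series {a : ℕ → ℝ} (h : Converges a) :
    HasSum (fun k => a (k + 1)) (series a) :=
  Summable.hasSum h

theorem Converges.hasSum_series_of_zero {a : ℕ → ℝ} (h : Converges a) (h0 : a 0 = 0) :
    HasSum a (series a) := by
  have := (hasSum_nat_add_iff (f := a) 1).1 h.hasSum_series
  simpa [h0] using this

/-! ### Harmonic numbers of negative index -/

theorem sum_range_sub_shift (φ : ℕ → ℝ) (k N : ℕ) :
    ∑ i ∈ Finset.range N, (φ i - φ (i + k)) =
      ∑ i ∈ Finset.range k, φ i - ∑ i ∈ Finset.range k, φ (N + i) := by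
  have h1 := Finset.sum_range_add φ N k
  have h2 := Finset.sum_range_add φ k N
  rw [Finset.sum_sub_distrib]
  simp only [add_comm _ k]
  rw [add_comm k N] at h2
  linarith

theorem hasSum_sub_shift {φ : ℕ → ℝ} (hφ : Filter.Tendsto φ Filter.atTop (nhds 0)) (k : ℕ)
    (hs : Summable fun i => φ i - φ (i + k)) :
    HasSum (fun i => φ i - φ (i + k)) (∑ i ∈ Finset.range k, φ i) := by
  have h := hs.hasSum.tendsto_sum_nat
  have h' : Filter.Tendsto (fun N => ∑ i ∈ Finset.range k, φ (N + i)) Filter.atTop (nhds 0) := by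
    have := tendsto_finsetSum (Finset.range k) (f := fun i N => φ (N + i)) (a := fun _ => 0)
      fun i _ => hφ.comp (Filter.tendsto_add_atTop_nat i)
    simpa using this
  have h'' := (tendsto_const_nhds (x := ∑ i ∈ Finset.range k, φ i)).sub h'
  rw [sub_zero] at h''
  have := tendsto_nhds_unique h (h''.congr fun N => (sum_range_sub_shift φ k N).symm)
  exact this ▸ hs.hasSum

theorem hasSum_sub_shift_natCast {φ : ℤ → ℝ} (hφ : Filter.Tendsto φ Filter.atTop (nhds 0)) (k : ℕ)
    (hs : Summable fun i : ℕ => φ i - φ (i + k)) :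
    HasSum (fun i : ℕ => φ i - φ (i + k)) (∑ i ∈ Finset.range k, φ i) := by
  have h := hasSum_sub_shift (hφ.comp tendsto_natCast_atTop_atTop) k
  simp only [Function.comp_apply, Nat.cast_add] at h
  exact h hs

/-- A telescoping sum in the other direction: the values of `φ` at `-k, …, -1` enter, and with them
the harmonic numbers of negative index. -/
theorem hasSum_sub_shift_neg_natCast {φ : ℤ → ℝ} (hφ : Filter.Tendsto φ Filter.atTop (nhds 0))
    (k : ℕ) (hs : Summable fun i : ℕ => φ i - φ (i + -k)) :
    HasSum (fun i : ℕ => φ i - φ (i + -k)) (-∑ i ∈ Finset.range k, φ (-(i + 1))) := by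
  have h := hasSum_sub_shift_natCast (φ := fun i => φ (i + -k))
    (hφ.comp (Filter.tendsto_atTop_add_const_right _ (-(k : ℤ)) Filter.tendsto_id)) k
    (hs.neg.congr fun i => by simp)
  refine hasSum_of_eq_of_eq h.neg (fun i => by simp) ?_
  rw [← Finset.sum_range_reflect]
  refine congrArg _ (Finset.sum_congr rfl fun i hi => ?_)
  have := Finset.mem_range.1 hi
  congr 1
  omega

/-- Two ways of summing a double series. -/
theorem hasSum_of_hasSum_swap {ι κ : Type*} {F : ι × κ → ℝ} (hF : Summable F) {g : ι → ℝ}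
    {h : κ → ℝ} {s : ℝ} (hg : ∀ i, HasSum (fun k => F (i, k)) (g i))
    (hh : ∀ k, HasSum (fun i => F (i, k)) (h k)) (hs : HasSum h s) : HasSum g s := by
  have h1 := hF.hasSum.prod_fiberwise hg
  have h2 := HasSum.prod_fiberwise (f := fun p : κ × ι => F p.swap)
    ((Equiv.prodComm κ ι).hasSum_iff.2 hF.hasSum) hh
  exact h2.unique hs ▸ h1

/-! ### The recursion and the starting values for the first family -/

theorem summable_oddDiff {n m : ℕ} (hm : 2 ≤ m) :
    Summable fun p : ℕ × ℤ => ((p.2 : ℝ)⁻¹) ^ m * oddDiff p.1 n p.2 := by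
  have h := ((summable_eulerTerm n hm).comp_injective
    (i := fun p : ℕ × ℤ => ((2 * p.1 + 1 : ℤ), 2 * p.2)) fun p q h => by
      simp only [Prod.mk.injEq] at h
      exact Prod.ext (by omega) (by omega)).mul_left (2 ^ m)
  refine h.congr fun p => ?_
  simp only [Function.comp_apply, eulerTerm, oddDiff]
  push_cast
  rw [← mul_assoc, ← mul_pow]
  congr 2
  · rcases eq_or_ne (p.2 : ℝ) 0 with h0 | h0
    · simp [h0]
    · field_simp
  · congr 2
    ring

theorem summable_oddDiff_left {n m : ℕ} (hm : 2 ≤ m) {k : ℤ} (hk : k ≠ 0) :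
    Summable fun i : ℕ => oddDiff i n k := by
  have h := (summable_oddDiff (n := n) hm).prod_symm.prod_factor k
  have hk' : ((k : ℝ)⁻¹) ^ m ≠ 0 := pow_ne_zero _ (inv_ne_zero (by exact_mod_cast hk))
  exact (summable_mul_left_iff hk').1 h

theorem tendsto_inv_odd_pow {n : ℕ} (hn : 1 ≤ n) :
    Filter.Tendsto (fun k : ℤ => ((2 * k + 1 : ℝ)⁻¹) ^ n) Filter.atTop (nhds 0) := by
  simpa [show n ≠ 0 by omega] using symmSumZero_inv_odd.top.pow n

theorem hasSum_oddDiff_natCast {n : ℕ} (hn : 1 ≤ n) {k : ℕ} (hk : k ≠ 0) :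
    HasSum (fun i : ℕ => oddDiff i n k) (oddHarm n k) := by
  have h := hasSum_sub_shift_natCast (tendsto_inv_odd_pow hn) k
  refine hasSum_of_eq_of_eq (h ?_) (fun i => ?_) ?_
  · refine (summable_oddDiff_left (n := n) le_rfl (k := k) (by exact_mod_cast hk)).congr
      fun i => ?_
    simp [oddDiff]
  · simp [oddDiff]
  · simp [oddHarm_eq_sum_range]

theorem hasSum_oddDiff_neg_natCast {n : ℕ} (hn : 1 ≤ n) {k : ℕ} (hk : k ≠ 0) :
    HasSum (fun i : ℕ => oddDiff i n (-k)) (-((-1) ^ n * oddHarm n k)) := by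
  have h := hasSum_sub_shift_neg_natCast (tendsto_inv_odd_pow hn) k
  refine hasSum_of_eq_of_eq (h ?_) (fun i => ?_) ?_
  · refine (summable_oddDiff_left (n := n) le_rfl (k := -k) (by omega)).congr fun i => ?_
    simp [oddDiff]
  · simp [oddDiff]
  · rw [oddHarm_eq_sum_range, Finset.mul_sum]
    refine congrArg _ (Finset.sum_congr rfl fun i _ => ?_)
    rw [← mul_pow]
    push_cast
    rw [show 2 * (-((i : ℝ) + 1)) + 1 = -(2 * i + 1) by ring, inv_neg, neg_one_mul]

/-- In odd weight the terms of `T¹` are even in `k`, once the odd harmonic numbers are extended to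
negative `k`. -/
theorem hasSum_oddU_T1 {n m : ℕ} (hn : 1 ≤ n) (hm : 2 ≤ m) (hnm : Odd (n + m)) :
    HasSum (fun i : ℕ => oddU i n m) (2 * T1 n m) := by
  have hF := summable_oddDiff (n := n) hm
  refine hasSum_of_hasSum_swap hF (h := fun k => ∑' i : ℕ, ((k : ℝ)⁻¹) ^ m * oddDiff i n k)
    (fun i => hasSum_oddU i n hm) (fun k => (hF.prod_symm.prod_factor k).hasSum) ?_
  have hT := converges_term1 hn hm
  rw [two_mul]
  refine HasSum.of_nat_of_neg_add_one ?_ ?_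
  · refine hasSum_of_eq (hT.hasSum_series_of_zero (by simp [term1, oddHarm])) fun k => ?_
    rcases eq_or_ne k 0 with rfl | hk
    · simp [term1, oddHarm, show m ≠ 0 by omega]
    · rw [((hasSum_oddDiff_natCast hn hk).mul_left _).tsum_eq, term1]
      simp [div_eq_mul_inv, mul_comm]
  · refine hasSum_of_eq hT.hasSum_series fun k => ?_
    have := ((hasSum_oddDiff_neg_natCast hn (k := k + 1) (by omega)).mul_left
      ((((-(k + 1 : ℕ) : ℤ) : ℝ)⁻¹) ^ m)).tsum_eq
    rw [show -((k : ℤ) + 1) = -((k + 1 : ℕ) : ℤ) by push_cast; rfl, this, term1]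
    push_cast
    rw [inv_neg, neg_pow, div_eq_mul_inv, ← inv_pow]
    have e : (-1 : ℝ) ^ m * (-1) ^ n = -1 := by rw [← pow_add, add_comm m n, hnm.neg_one_pow]
    linear_combination (oddHarm n (k + 1) * ((k + 1 : ℝ)⁻¹) ^ m) * e

theorem T1_recursion {n m : ℕ} (hn : 1 ≤ n) (hm : 2 ≤ m) (hnm : Odd (n + 1 + m)) :
    (n : ℝ) * T1 (n + 1) m =
      2 * ∑ i ∈ Finset.Icc 1 (n / 2), lambdaVal (2 * i) * T1 (n + 1 - 2 * i) m
      + ∑ i ∈ Finset.Icc 1 ((m - 1) / 2), zetaVal (2 * i) * T1 n (m + 1 - 2 * i)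
      - ((m : ℝ) + 1) / 2 * T1 n (m + 1) := by
  have h0 := (hasSum_oddU_T1 (n := n + 1) (by omega) hm hnm).mul_left (n : ℝ)
  have h1 : HasSum (fun r : ℕ => ∑ i ∈ Finset.Icc 1 (n / 2),
      lambdaVal (2 * i) * oddU r (n + 1 - 2 * i) m)
      (∑ i ∈ Finset.Icc 1 (n / 2), lambdaVal (2 * i) * (2 * T1 (n + 1 - 2 * i) m)) :=
    hasSum_sum fun i hi => by
      have := Finset.mem_Icc.1 hi
      refine (hasSum_oddU_T1 (by omega) hm ?_).mul_left _
      rw [Nat.odd_iff] at hnm ⊢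
      omega
  have h2 : HasSum (fun r : ℕ => ∑ i ∈ Finset.Icc 1 ((m - 1) / 2),
      zetaVal (2 * i) * oddU r n (m + 1 - 2 * i))
      (∑ i ∈ Finset.Icc 1 ((m - 1) / 2), zetaVal (2 * i) * (2 * T1 n (m + 1 - 2 * i))) :=
    hasSum_sum fun i hi => by
      have := Finset.mem_Icc.1 hi
      refine (hasSum_oddU_T1 hn (by omega) ?_).mul_left _
      rw [Nat.odd_iff] at hnm ⊢
      omega
  have h3 := (hasSum_oddU_T1 (n := n) (m := m + 1) hn (by omega)
    (by rwa [show n + (m + 1) = n + 1 + m by ring])).mul_left (((m : ℝ) + 1) / 2)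
  have h := h0.unique (hasSum_of_eq (((h1.mul_left 2).add h2).sub h3) fun r =>
    (oddU_recursion r hn hm).symm)
  simp only [mul_left_comm _ (2 : ℝ) (T1 _ _), ← Finset.mul_sum] at h
  linarith

theorem sum_Icc_one_succ (f : ℕ → ℝ) (q : ℕ) :
    ∑ j ∈ Finset.Icc 1 (q + 1), f j = f 1 + ∑ j ∈ Finset.Icc 1 q, f (j + 1) := by
  induction q with
  | zero => simp
  | succ q ih =>
    rw [Finset.sum_Icc_succ_top (by omega), ih, Finset.sum_Icc_succ_top (by omega), add_assoc]

/-- `∑_{k ≠ 0} 1 / (kᵖ (a + 2k))` over the integers, for odd `p = 2q + 1` and `a = 2r + 1`. -/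
theorem hasSum_inv_pow_mul_inv_odd_add (r : ℤ) (q : ℕ) :
    HasSum (fun k : ℤ => ((k : ℝ)⁻¹) ^ (2 * q + 1) * (2 * (r + k) + 1 : ℝ)⁻¹)
      (2 * 4 ^ q * ((2 * r + 1 : ℝ)⁻¹) ^ (2 * q + 2) -
        ∑ j ∈ Finset.Icc 1 q,
          4 ^ j * zetaVal (2 * q + 2 - 2 * j) * ((2 * r + 1 : ℝ)⁻¹) ^ (2 * j)) := by
  have ha := two_mul_intCast_add_one_ne_zero r
  induction q with
  | zero =>
    have h := (Equiv.hasSum_iff (Equiv.addLeft r)).2 (hasSum_inv_odd_mul_inv_sub r)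
    refine hasSum_of_eq_of_eq h.neg (fun k => ?_) ?_
    · simp only [Function.comp_apply, Equiv.coe_addLeft]
      push_cast
      rw [sub_add_cancel_left, inv_neg]
      ring
    · simp
  | succ q ih =>
    set t : ℝ := (2 * r + 1 : ℝ)⁻¹ with ht
    have hz := hasSum_int_inv_pow (s := 2 * q + 2) (by omega)
    have hz' := hasSum_int_inv_pow (s := 2 * q + 3) (by omega)
    have h := ((hz'.sub ((hz.sub (ih.mul_left 2)).mul_left (2 * t)))).mul_left t
    refine hasSum_of_eq_of_eq h (fun k => ?_) ?_
    · rcases eq_or_ne k 0 with rfl | hk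
      · simp
      have hk' : (k : ℝ) ≠ 0 := by exact_mod_cast hk
      have hrk := two_mul_intCast_add_one_ne_zero (r + k)
      push_cast at hrk
      rw [show 2 * (q + 1) + 1 = 2 * q + 1 + 2 by ring, show 2 * q + 3 = 2 * q + 1 + 2 by ring,
        pow_add _ (2 * q + 1) 2, show 2 * q + 2 = 2 * q + 1 + 1 by ring,
        pow_add _ (2 * q + 1) 1, ht]
      generalize ((k : ℝ)⁻¹) ^ (2 * q + 1) = v
      field_simp
      ring
    · rw [sum_Icc_one_succ, show 2 * q + 3 = 2 * (q + 1) + 1 by ring, pow_succ _ (2 * (q + 1)),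
        show 2 * q + 2 = 2 * (q + 1) by ring, pow_mul]
      have e : ∑ j ∈ Finset.Icc 1 q, (4 : ℝ) ^ (j + 1) *
          zetaVal (2 * (q + 1) + 2 - 2 * (j + 1)) * t ^ (2 * (j + 1)) =
          4 * t ^ 2 * ∑ j ∈ Finset.Icc 1 q, 4 ^ j * zetaVal (2 * (q + 1) - 2 * j) *
            t ^ (2 * j) := by
        rw [Finset.mul_sum]
        refine Finset.sum_congr rfl fun j _ => ?_
        rw [show 2 * (q + 1) + 2 - 2 * (j + 1) = 2 * (q + 1) - 2 * j by omega]
        ring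
      rw [e, show 2 * (q + 1) + 2 - 2 * 1 = 2 * (q + 1) by omega]
      norm_num
      ring

theorem oddU_one (r : ℤ) (q : ℕ) :
    oddU r 1 (2 * q + 2) = 2 * (2 * 4 ^ q * ((2 * r + 1 : ℝ)⁻¹) ^ (2 * q + 3) -
        ∑ j ∈ Finset.Icc 1 q,
          4 ^ j * zetaVal (2 * q + 2 - 2 * j) * ((2 * r + 1 : ℝ)⁻¹) ^ (2 * j + 1)) := by
  have ha := two_mul_intCast_add_one_ne_zero r
  have h := (hasSum_inv_pow_mul_inv_odd_add r q).mul_left (2 * (2 * r + 1 : ℝ)⁻¹)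
  refine HasSum.tsum_eq (hasSum_of_eq_of_eq h (fun k => ?_) ?_)
  · rcases eq_or_ne k 0 with rfl | hk
    · simp
    have hk' : (k : ℝ) ≠ 0 := by exact_mod_cast hk
    have hrk := two_mul_intCast_add_one_ne_zero (r + k)
    push_cast at hrk
    rw [oddDiff, show 2 * q + 2 = 2 * q + 1 + 1 by ring, pow_add _ (2 * q + 1) 1]
    generalize ((k : ℝ)⁻¹) ^ (2 * q + 1) = v
    field_simp
    ring
  · rw [mul_assoc, mul_sub, Finset.mul_sum]
    congr 2
    · ring
    · refine Finset.sum_congr rfl fun j _ => ?_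
      ring

theorem four_pow_mul_lambdaVal (j : ℕ) :
    4 ^ j * lambdaVal (2 * j + 1) = ((2 : ℝ) ^ (2 * j + 1) - 1) / 2 * zetaVal (2 * j + 1) := by
  rw [lambdaVal, show (4 : ℝ) ^ j = 2 ^ (2 * j) by rw [pow_mul]; norm_num, pow_succ]
  field_simp

theorem T1_one {q : ℕ} (hq : 1 ≤ q) :
    T1 1 (2 * q) = ((2 : ℝ) ^ (2 * q + 1) - 1) / 4 * zetaVal (2 * q + 1)
      - 1 / 2 * ∑ j ∈ Finset.Icc 1 (q - 1),
          ((2 : ℝ) ^ (2 * j + 1) - 1) * zetaVal (2 * j + 1) * zetaVal (2 * q - 2 * j) := by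
  obtain ⟨q, rfl⟩ : ∃ l, q = l + 1 := ⟨q - 1, by omega⟩
  have h1 := hasSum_oddU_T1 (n := 1) (m := 2 * q + 2) le_rfl (by omega)
    (by rw [Nat.odd_iff]; omega)
  have h2 : HasSum (fun r : ℕ => ∑ j ∈ Finset.Icc 1 q,
      4 ^ j * zetaVal (2 * q + 2 - 2 * j) * ((2 * r + 1 : ℝ)⁻¹) ^ (2 * j + 1))
      (∑ j ∈ Finset.Icc 1 q, 4 ^ j * zetaVal (2 * q + 2 - 2 * j) * lambdaVal (2 * j + 1)) :=
    hasSum_sum fun j hj => (hasSum_lambdaVal (by have := Finset.mem_Icc.1 hj; omega)).mul_left _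
  have h3 := (((hasSum_lambdaVal (s := 2 * q + 3) (by omega)).mul_left (2 * 4 ^ q)).sub h2).mul_left
    2
  have h := h1.unique (hasSum_of_eq h3 fun r => by rw [oddU_one]; push_cast; rfl)
  have e : ∑ j ∈ Finset.Icc 1 q, 4 ^ j * zetaVal (2 * q + 2 - 2 * j) * lambdaVal (2 * j + 1) =
      1 / 2 * ∑ j ∈ Finset.Icc 1 q,
        ((2 : ℝ) ^ (2 * j + 1) - 1) * zetaVal (2 * j + 1) * zetaVal (2 * q + 2 - 2 * j) := by
    rw [Finset.mul_sum]
    refine Finset.sum_congr rfl fun j _ => ?_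
    linear_combination zetaVal (2 * q + 2 - 2 * j) * four_pow_mul_lambdaVal j
  have e' := four_pow_mul_lambdaVal (q + 1)
  rw [e] at h
  rw [show 2 * (q + 1) = 2 * q + 2 by ring] at e' ⊢
  rw [Nat.add_sub_cancel]
  rw [pow_succ (4 : ℝ)] at e'
  linarith

/-! ### Membership in the rings of zeta values -/

theorem ratCast_mem_zetaAlg (x : ℚ) : (x : ℝ) ∈ zetaAlg := by
  simpa using zetaAlg.algebraMap_mem x

theorem natCast_mem_zetaAlg (x : ℕ) : (x : ℝ) ∈ zetaAlg := natCast_mem _ x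

theorem zetaVal_mem_zetaAlg {s : ℕ} (hs : 2 ≤ s) : zetaVal s ∈ zetaAlg :=
  Algebra.subset_adjoin ⟨s, hs, rfl⟩

theorem lambdaVal_mem_zetaAlg {s : ℕ} (hs : 2 ≤ s) : lambdaVal s ∈ zetaAlg := by
  refine mul_mem ?_ (zetaVal_mem_zetaAlg hs)
  simpa using ratCast_mem_zetaAlg (1 - 1 / 2 ^ s)

theorem zetaAlg_le_zetaLogAlg : zetaAlg ≤ zetaLogAlg :=
  Algebra.adjoin_mono (Set.subset_insert _ _)

theorem log_two_mem_zetaLogAlg : Real.log 2 ∈ zetaLogAlg :=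
  Algebra.subset_adjoin (Set.mem_insert _ _)

theorem T1_mem_zetaAlg {n m : ℕ} (hn : 1 ≤ n) (hm : 2 ≤ m) (hnm : Odd (n + m)) :
    T1 n m ∈ zetaAlg := by
  induction n using Nat.strong_induction_on generalizing m with
  | _ n ih =>
    rw [Nat.odd_iff] at hnm
    obtain ⟨n, rfl⟩ : ∃ l, n = l + 1 := ⟨n - 1, by omega⟩
    rcases Nat.eq_zero_or_pos n with rfl | hn'
    · obtain ⟨q, rfl⟩ : ∃ q, m = 2 * q := ⟨m / 2, by omega⟩
      rw [zero_add, T1_one (by omega)]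
      refine sub_mem (mul_mem ?_ (zetaVal_mem_zetaAlg (by omega)))
        (mul_mem ?_ (sum_mem fun j hj => ?_))
      · simpa using ratCast_mem_zetaAlg (((2 : ℚ) ^ (2 * q + 1) - 1) / 4)
      · simpa using ratCast_mem_zetaAlg (1 / 2)
      · have := Finset.mem_Icc.1 hj
        refine mul_mem (mul_mem ?_ (zetaVal_mem_zetaAlg (by omega)))
          (zetaVal_mem_zetaAlg (by omega))
        simpa using ratCast_mem_zetaAlg ((2 : ℚ) ^ (2 * j + 1) - 1)
    · have h := T1_recursion hn' hm (by rw [Nat.odd_iff]; omega)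
      have hn0 : (n : ℝ) ≠ 0 := by exact_mod_cast hn'.ne'
      rw [← inv_mul_cancel_left₀ hn0 (T1 (n + 1) m), h]
      have hmul : ∀ (a : ℚ) {x : ℝ}, x ∈ zetaAlg → (a : ℝ) * x ∈ zetaAlg :=
        fun a x hx => mul_mem (ratCast_mem_zetaAlg a) hx
      have h1 : ∑ i ∈ Finset.Icc 1 (n / 2), lambdaVal (2 * i) * T1 (n + 1 - 2 * i) m ∈ zetaAlg :=
        sum_mem fun i hi => by
          have := Finset.mem_Icc.1 hi
          exact mul_mem (lambdaVal_mem_zetaAlg (by omega))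
            (ih _ (by omega) (by omega) hm (by rw [Nat.odd_iff]; omega))
      have h2 : ∑ i ∈ Finset.Icc 1 ((m - 1) / 2), zetaVal (2 * i) * T1 n (m + 1 - 2 * i) ∈
          zetaAlg :=
        sum_mem fun i hi => by
          have := Finset.mem_Icc.1 hi
          exact mul_mem (zetaVal_mem_zetaAlg (by omega))
            (ih _ (by omega) hn' (by omega) (by rw [Nat.odd_iff]; omega))
      have h3 : T1 n (m + 1) ∈ zetaAlg :=
        ih _ (by omega) hn' (by omega) (by rw [Nat.odd_iff]; omega)
      simpa using hmul ((n : ℚ)⁻¹) (sub_mem (add_mem (hmul 2 h1) h2) (hmul (((m : ℚ) + 1) / 2) h3))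

/-! ### The relations between the families -/

theorem sum_range_mul_partialSum (α β : ℕ → ℝ) (N : ℕ) :
    ∑ k ∈ Finset.range N, ((∑ i ∈ Finset.range (k + 1), α i) * β k +
      (∑ i ∈ Finset.range (k + 1), β i) * α k - α k * β k) =
      (∑ i ∈ Finset.range N, α i) * ∑ i ∈ Finset.range N, β i := by
  induction N with
  | zero => simp
  | succ N ih =>
    rw [Finset.sum_range_succ, ih]
    simp only [Finset.sum_range_succ]
    ring

/-- The product `ζ(n) λ(m)`, split along the diagonal. -/
theorem T6_eq {n m : ℕ} (hn : 2 ≤ n) (hm : 2 ≤ m) :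
    T6 n m = zetaVal n * lambdaVal m + D n m - T1 m n := by
  have h6 := (converges_term6 (n := n) (m := m) (by omega) hm).hasSum_series
  have h1 := (converges_term1 (n := m) (m := n) (by omega) hn).hasSum_series
  have hD := (converges_termD (n := n) (m := m) (by omega)).hasSum_series
  have h := ((h6.add h1).sub hD).tendsto_sum_nat
  have h' := (hasSum_zetaVal_succ hn).tendsto_sum_nat.mul (hasSum_lambdaVal hm).tendsto_sum_nat
  have := tendsto_nhds_unique h (h'.congr fun N => by
    rw [← sum_range_mul_partialSum]
    refine Finset.sum_congr rfl fun k _ => ?_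
    rw [term6, term1, termD, ← harm_eq_sum_range, ← oddHarm_eq_sum_range]
    push_cast
    rw [show 2 * ((k : ℝ) + 1) - 1 = 2 * k + 1 by ring, inv_pow, inv_pow, one_div, mul_inv,
      div_eq_mul_inv, div_eq_mul_inv])
  change T6 n m + T1 m n - D n m = _ at this
  linarith

theorem harm_two_mul (n k : ℕ) : harm n (2 * k) = oddHarm n k + 1 / 2 ^ n * harm n k := by
  simp only [harm_eq_sum_range, oddHarm_eq_sum_range]
  induction k with
  | zero => simp
  | succ k ih =>
    rw [show 2 * (k + 1) = 2 * k + 1 + 1 by ring, Finset.sum_range_succ, Finset.sum_range_succ, ih,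
      Finset.sum_range_succ, Finset.sum_range_succ]
    push_cast
    rw [show 2 * (k : ℝ) + 1 + 1 = 2 * (k + 1) by ring, mul_inv, mul_pow, inv_pow 2]
    ring

theorem harm_succ (n k : ℕ) : harm n (k + 1) = harm n k + 1 / (k + 1 : ℝ) ^ n := by
  simp [harm_eq_sum_range, Finset.sum_range_succ]

theorem oddHarm_succ (n k : ℕ) : oddHarm n (k + 1) = oddHarm n k + 1 / (2 * k + 1 : ℝ) ^ n := by
  simp [oddHarm_eq_sum_range, Finset.sum_range_succ]

/-- Separation of the even and the odd denominators in `S_{n,m}`. -/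
theorem T3_eq {n m : ℕ} (hn : 1 ≤ n) (hm : 2 ≤ m) :
    T3 n m = (1 - 1 / 2 ^ (n + m)) * S n m - 1 / 2 ^ m * T1 n m
      - 1 / 2 ^ n * (T6 n m - D n m) := by
  have hS := (converges_termS hn hm).hasSum_series
  have h1 := (converges_term1 hn hm).hasSum_series
  have h3 := (converges_term3 hn hm).hasSum_series
  have h6 := (converges_term6 hn hm).hasSum_series
  have hD := (converges_termD (n := n) (m := m) (by omega)).hasSum_series
  have hodd : HasSum (fun l : ℕ => termS n m (2 * l + 1))
      (T3 n m + 1 / 2 ^ n * (T6 n m - D n m)) := by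
    refine hasSum_of_eq (h3.add ((h6.sub hD).mul_left (1 / 2 ^ n))) fun l => ?_
    simp only [term3, term6, termD, termS]
    rw [harm_succ n (2 * l), harm_two_mul, harm_succ n l, oddHarm_succ]
    push_cast
    rw [show 2 * ((l : ℝ) + 1) - 1 = 2 * l + 1 by ring]
    field_simp
    ring
  have heven : HasSum (fun l : ℕ => termS n m (2 * l + 1 + 1))
      (1 / 2 ^ m * (T1 n m + 1 / 2 ^ n * S n m)) := by
    refine hasSum_of_eq ((h1.add (hS.mul_left (1 / 2 ^ n))).mul_left (1 / 2 ^ m)) fun l => ?_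
    simp only [term1, termS]
    rw [show 2 * l + 1 + 1 = 2 * (l + 1) by ring, harm_two_mul]
    push_cast
    rw [mul_pow]
    field_simp
  have h := (HasSum.even_add_odd (f := fun k => termS n m (k + 1)) hodd heven).unique hS
  change _ = S n m at h
  rw [pow_add]
  linear_combination h

/-! ### The sums `D_{n,m}` and `ln 2` -/

/-- The partial sums are differences `H_{2N} - H_N` of harmonic numbers, and `H_N - ln N`
converges. -/
theorem hasSum_log_two :
    HasSum (fun k : ℕ => (2 * k + 1 : ℝ)⁻¹ - (2 * (k + 1) : ℝ)⁻¹) (Real.log 2) := by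
  have hs : Summable fun k : ℕ => (2 * k + 1 : ℝ)⁻¹ - (2 * (k + 1) : ℝ)⁻¹ := by
    refine (Summable.mul_left (1 / 2) (converges_termD (n := 1) (m := 1) le_rfl)).congr
      fun k => ?_
    rw [termD]
    push_cast
    rw [show 2 * ((k : ℝ) + 1) - 1 = 2 * k + 1 by ring]
    field_simp
    ring
  have hsum : ∀ N : ℕ, ∑ k ∈ Finset.range N, ((2 * k + 1 : ℝ)⁻¹ - (2 * (k + 1) : ℝ)⁻¹) =
      harmonic (2 * N) - harmonic N := by
    intro N
    induction N with
    | zero => simp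
    | succ N ih =>
      rw [Finset.sum_range_succ, ih, show 2 * (N + 1) = 2 * N + 1 + 1 by ring, harmonic_succ,
        harmonic_succ, harmonic_succ]
      push_cast
      field_simp
      ring
  have h := Real.tendsto_harmonic_sub_log
  have h2 := h.comp (Filter.tendsto_id.const_mul_atTop' (two_pos : 0 < 2))
  have h3 := ((h2.sub h).add_const (Real.log 2))
  rw [sub_self, zero_add] at h3
  have := tendsto_nhds_unique hs.hasSum.tendsto_sum_nat (h3.congr' ?_)
  · exact this ▸ hs.hasSum
  · filter_upwards [Filter.eventually_ge_atTop 1] with N hN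
    have hN' : (N : ℝ) ≠ 0 := by positivity
    rw [hsum]
    simp only [Function.comp_apply, id]
    push_cast
    rw [Real.log_mul two_ne_zero hN']
    ring

theorem D_one_one : D 1 1 = 2 * Real.log 2 := by
  refine HasSum.tsum_eq (hasSum_of_eq (hasSum_log_two.mul_left 2) fun k => ?_)
  rw [termD]
  push_cast
  rw [show 2 * ((k : ℝ) + 1) - 1 = 2 * k + 1 by ring]
  field_simp
  ring

theorem D_zero_left {m : ℕ} (hm : 2 ≤ m) : D 0 m = lambdaVal m := by
  refine HasSum.tsum_eq (hasSum_of_eq (hasSum_lambdaVal hm) fun k => ?_)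
  rw [termD]
  push_cast
  rw [show 2 * ((k : ℝ) + 1) - 1 = 2 * k + 1 by ring]
  simp

theorem D_zero_right {n : ℕ} (hn : 2 ≤ n) : D n 0 = zetaVal n := by
  refine HasSum.tsum_eq (hasSum_of_eq (hasSum_zetaVal_succ hn) fun k => ?_)
  simp [termD]

theorem D_succ_succ {n m : ℕ} (hnm : 1 ≤ n + m) :
    D (n + 1) (m + 1) = 2 * D n (m + 1) - D (n + 1) m := by
  have h1 := (converges_termD (n := n) (m := m + 1) (by omega)).hasSum_series
  have h2 := (converges_termD (n := n + 1) (m := m) (by omega)).hasSum_series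
  refine HasSum.tsum_eq (hasSum_of_eq ((h1.mul_left 2).sub h2) fun k => ?_)
  simp only [termD]
  push_cast
  rw [show 2 * ((k : ℝ) + 1) - 1 = 2 * k + 1 by ring]
  field_simp
  ring

theorem exists_two_mul_sub_sub_log_mem {x y : ℝ} (hx : ∃ r : ℚ, x - r * Real.log 2 ∈ zetaAlg)
    (hy : ∃ r : ℚ, y - r * Real.log 2 ∈ zetaAlg) :
    ∃ r : ℚ, 2 * x - y - r * Real.log 2 ∈ zetaAlg := by
  obtain ⟨r, hr⟩ := hx
  obtain ⟨s, hs⟩ := hy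
  refine ⟨2 * r - s, ?_⟩
  have := sub_mem (mul_mem (natCast_mem_zetaAlg 2) hr) hs
  convert this using 1
  push_cast
  ring

theorem exists_sub_log_mem_of_mem {x : ℝ} (hx : x ∈ zetaAlg) :
    ∃ r : ℚ, x - r * Real.log 2 ∈ zetaAlg :=
  ⟨0, by simpa using hx⟩

/-- Partial fractions reduce `D_{n,m}` to zeta values and `D_{1,1} = 2 ln 2`. -/
theorem exists_D_sub_log_mem {n m : ℕ} (hn : 1 ≤ n) (hm : 1 ≤ m) :
    ∃ r : ℚ, D n m - r * Real.log 2 ∈ zetaAlg := by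
  induction n, hn using Nat.le_induction generalizing m with
  | base =>
    induction m, hm using Nat.le_induction with
    | base => exact ⟨2, by simp [D_one_one]⟩
    | succ m hm ih =>
      have h := D_succ_succ (n := 0) (m := m) (by omega)
      rw [zero_add, D_zero_left (by omega)] at h
      rw [h]
      exact exists_two_mul_sub_sub_log_mem
        (exists_sub_log_mem_of_mem (lambdaVal_mem_zetaAlg (by omega))) ih
  | succ n hn ihn =>
    induction m, hm using Nat.le_induction with
    | base =>
      have h := D_succ_succ (n := n) (m := 0) (by omega)
      rw [zero_add, D_zero_right (by omega)] at h
      rw [h]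
      exact exists_two_mul_sub_sub_log_mem (ihn le_rfl)
        (exists_sub_log_mem_of_mem (zetaVal_mem_zetaAlg (by omega)))
    | succ m hm ih =>
      rw [D_succ_succ (by omega)]
      exact exists_two_mul_sub_sub_log_mem (ihn (by omega)) ih

/-! ### Sequences spanned by inverse powers -/

/-- The span, over the ring of zeta values, of the sequences `i ↦ 1 / (x i)ʲ` with `j ≥ s`. -/
noncomputable def invPowSpan (x : ℕ → ℝ) (s : ℕ) : Submodule zetaAlg (ℕ → ℝ) :=
  Submodule.span zetaAlg {f | ∃ j, s ≤ j ∧ f = fun i => ((x i)⁻¹) ^ j}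

theorem invPowSpan_anti (x : ℕ → ℝ) {s t : ℕ} (h : s ≤ t) : invPowSpan x t ≤ invPowSpan x s :=
  Submodule.span_mono fun _ ⟨j, hj, e⟩ => ⟨j, h.trans hj, e⟩

theorem const_mul_mem_invPowSpan {x : ℕ → ℝ} {s : ℕ} {f : ℕ → ℝ} (hf : f ∈ invPowSpan x s) {c : ℝ}
    (hc : c ∈ zetaAlg) : (fun i => c * f i) ∈ invPowSpan x s :=
  (invPowSpan x s).smul_mem ⟨c, hc⟩ hf

theorem inv_pow_mem_invPowSpan (x : ℕ → ℝ) {s j : ℕ} (h : s ≤ j) :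
    (fun i => ((x i)⁻¹) ^ j) ∈ invPowSpan x s :=
  Submodule.subset_span ⟨j, h, rfl⟩

theorem inv_mul_mem_invPowSpan {x : ℕ → ℝ} {s : ℕ} {f : ℕ → ℝ} (hf : f ∈ invPowSpan x s) :
    (fun i => (x i)⁻¹ * f i) ∈ invPowSpan x (s + 1) := by
  induction hf using Submodule.span_induction with
  | mem f hf =>
    obtain ⟨j, hj, rfl⟩ := hf
    simp only [← pow_succ']
    exact inv_pow_mem_invPowSpan x (by omega)
  | zero =>
    convert (invPowSpan x (s + 1)).zero_mem using 1
    ext i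
    simp
  | add f g _ _ hf hg =>
    convert (invPowSpan x (s + 1)).add_mem hf hg using 1
    ext i
    simp [mul_add]
  | smul c f _ hf =>
    refine (funext fun i => ?_ : (fun i => (x i)⁻¹ * (c • f) i) = _) ▸
      const_mul_mem_invPowSpan hf c.2
    change (x i)⁻¹ * ((c : ℝ) * f i) = _
    ring

theorem exists_hasSum_of_mem_invPowSpan {x : ℕ → ℝ}
    (hx : ∀ j, 2 ≤ j → ∃ c ∈ zetaAlg, HasSum (fun i => ((x i)⁻¹) ^ j) c) {f : ℕ → ℝ}
    (hf : f ∈ invPowSpan x 2) : ∃ c ∈ zetaAlg, HasSum f c := by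
  induction hf using Submodule.span_induction with
  | mem f hf =>
    obtain ⟨j, hj, rfl⟩ := hf
    exact hx j hj
  | zero => exact ⟨0, zero_mem _, hasSum_zero⟩
  | add f g _ _ hf hg =>
    obtain ⟨c, hc, hfc⟩ := hf
    obtain ⟨d, hd, hgd⟩ := hg
    exact ⟨c + d, add_mem hc hd, hfc.add hgd⟩
  | smul a f _ hf =>
    obtain ⟨c, hc, hfc⟩ := hf
    exact ⟨a * c, mul_mem a.2 hc, hfc.mul_left (a : ℝ)⟩

/-- A sequence `x` of positive numbers and a symmetric arithmetic progression `y` for which the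
sums `∑_k 1 / (y_kᵖ (x_i + y_k)ⁿ)` can be evaluated by partial fractions. The numbers `x_i` are
the positive integers, or the positive odd ones, and `y` runs over all integers, or over all odd
ones; terms with a vanishing denominator are dropped. -/
structure PartialFractionPair (x : ℕ → ℝ) (y : ℤ → ℝ) : Prop where
  ne_zero : ∀ i, x i ≠ 0
  pole : ∀ i, ∃ k₀, ∀ k, x i + y k = 0 ↔ k = k₀
  sum_x : ∀ j, 2 ≤ j → ∃ c ∈ zetaAlg, HasSum (fun i => ((x i)⁻¹) ^ j) c
  sum_y : ∀ j, 2 ≤ j → ∃ c ∈ zetaAlg, HasSum (fun k => ((y k)⁻¹) ^ j) c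
  base : ∃ c : ℕ, ∀ i, HasSum (fun k => (y k)⁻¹ * (x i + y k)⁻¹) (c * ((x i)⁻¹) ^ 2)

/-- The sums `∑_k 1 / (y_kᵖ (x_i + y_k))` are combinations of inverse powers of `x_i`. -/
theorem PartialFractionPair.exists_hasSum_one {x : ℕ → ℝ} {y : ℤ → ℝ}
    (h : PartialFractionPair x y) {p : ℕ} (hp : 1 ≤ p) :
    ∃ f ∈ invPowSpan x 1, ∀ i, HasSum (fun k => ((y k)⁻¹) ^ p * (x i + y k)⁻¹) (f i) := by
  induction p, hp using Nat.le_induction with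
  | base =>
    obtain ⟨c, hc⟩ := h.base
    refine ⟨fun i => c * ((x i)⁻¹) ^ 2, ?_, fun i => by simpa using hc i⟩
    exact const_mul_mem_invPowSpan (inv_pow_mem_invPowSpan x one_le_two) (natCast_mem_zetaAlg c)
  | succ p hp ih =>
    obtain ⟨f, hf, hfs⟩ := ih
    obtain ⟨c, hc, hcs⟩ := h.sum_y (p + 1) (by omega)
    refine ⟨fun i => c * ((x i)⁻¹) ^ 1 - (x i)⁻¹ * f i + (-1) ^ p * ((x i)⁻¹) ^ (p + 2), ?_,
      fun i => ?_⟩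
    · refine add_mem (sub_mem (const_mul_mem_invPowSpan (inv_pow_mem_invPowSpan x le_rfl) hc)
        (invPowSpan_anti x (by omega) (inv_mul_mem_invPowSpan hf)))
        (const_mul_mem_invPowSpan (inv_pow_mem_invPowSpan x (by omega)) ?_)
      exact pow_mem (neg_mem (one_mem _)) p
    · obtain ⟨k₀, hk₀⟩ := h.pole i
      have hx := h.ne_zero i
      refine hasSum_of_eq_of_eq (((hcs.mul_left ((x i)⁻¹)).sub ((hfs i).mul_left ((x i)⁻¹))).add
        (hasSum_ite_eq k₀ ((-1) ^ p * ((x i)⁻¹) ^ (p + 2)))) (fun k => ?_) (by ring)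
      by_cases hk : k = k₀
      · have hz := (hk₀ k).2 hk
        have hy : y k = -x i := by linarith
        rw [if_pos hk, hz, hy, inv_neg, neg_pow, inv_zero]
        ring
      · have hz : x i + y k ≠ 0 := fun e => hk ((hk₀ k).1 e)
        rw [if_neg hk]
        rcases eq_or_ne (y k) 0 with hy | hy
        · simp [hy, show p ≠ 0 by omega]
        · rw [pow_succ]
          field_simp
          ring

/-- The sums `∑_k (1 / x_i - 1 / (x_i + y_k)) / y_kᵐ` are combinations of inverse powers of `x_i`
with exponent at least two, hence summable over `i`. -/
theorem PartialFractionPair.exists_hasSum_inv_sub {x : ℕ → ℝ} {y : ℤ → ℝ}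
    (h : PartialFractionPair x y) {m : ℕ} (hm : 2 ≤ m) :
    ∃ f ∈ invPowSpan x 2,
      ∀ i, HasSum (fun k => ((y k)⁻¹) ^ m * ((x i)⁻¹ - (x i + y k)⁻¹)) (f i) := by
  obtain ⟨p, rfl⟩ : ∃ p, m = p + 1 := ⟨m - 1, by omega⟩
  obtain ⟨f, hf, hfs⟩ := h.exists_hasSum_one (p := p) (by omega)
  refine ⟨fun i => (x i)⁻¹ * f i + (-1) ^ (p + 1) * ((x i)⁻¹) ^ (p + 2), ?_, fun i => ?_⟩
  · refine add_mem (inv_mul_mem_invPowSpan hf)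
      (const_mul_mem_invPowSpan (inv_pow_mem_invPowSpan x (by omega)) ?_)
    exact pow_mem (neg_mem (one_mem _)) _
  · obtain ⟨k₀, hk₀⟩ := h.pole i
    have hx := h.ne_zero i
    refine hasSum_of_eq (((hfs i).mul_left ((x i)⁻¹)).add
      (hasSum_ite_eq k₀ ((-1) ^ (p + 1) * ((x i)⁻¹) ^ (p + 2)))) fun k => ?_
    by_cases hk : k = k₀
    · have hz := (hk₀ k).2 hk
      have hy : y k = -x i := by linarith
      rw [if_pos hk, hz, hy, inv_neg, neg_pow, neg_pow ((x i)⁻¹), inv_zero]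
      ring
    · have hz : x i + y k ≠ 0 := fun e => hk ((hk₀ k).1 e)
      rw [if_neg hk]
      rcases eq_or_ne (y k) 0 with hy | hy
      · simp [hy, show p ≠ 0 by omega]
      · rw [pow_succ]
        field_simp
        ring

theorem PartialFractionPair.exists_hasSum_succ_succ {x : ℕ → ℝ} {y : ℤ → ℝ}
    (h : PartialFractionPair x y) {s p n : ℕ} (hp : 1 ≤ p) (hn : 1 ≤ n)
    (h1 : ∃ f ∈ invPowSpan x s,
      ∀ i, HasSum (fun k => ((y k)⁻¹) ^ (p + 1) * ((x i + y k)⁻¹) ^ n) (f i))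
    (h2 : ∃ f ∈ invPowSpan x s,
      ∀ i, HasSum (fun k => ((y k)⁻¹) ^ p * ((x i + y k)⁻¹) ^ (n + 1)) (f i)) :
    ∃ f ∈ invPowSpan x (s + 1),
      ∀ i, HasSum (fun k => ((y k)⁻¹) ^ (p + 1) * ((x i + y k)⁻¹) ^ (n + 1)) (f i) := by
  obtain ⟨f, hf, hfs⟩ := h1
  obtain ⟨g, hg, hgs⟩ := h2
  refine ⟨fun i => (x i)⁻¹ * f i - (x i)⁻¹ * g i,
    sub_mem (inv_mul_mem_invPowSpan hf) (inv_mul_mem_invPowSpan hg), fun i => ?_⟩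
  have hx := h.ne_zero i
  refine hasSum_of_eq (((hfs i).mul_left ((x i)⁻¹)).sub ((hgs i).mul_left ((x i)⁻¹))) fun k => ?_
  rcases eq_or_ne (y k) 0 with hy | hy
  · simp [hy, show p ≠ 0 by omega]
  rcases eq_or_ne (x i + y k) 0 with hz | hz
  · simp [hz, show n ≠ 0 by omega]
  rw [pow_succ, pow_succ _ n]
  field_simp
  ring

theorem partialFractionPair_int :
    PartialFractionPair (fun i => (i + 1 : ℝ)) (fun k => (k : ℝ)) where
  ne_zero i := by positivity
  pole i := ⟨-(i + 1), fun k => by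
    rw [← Int.cast_natCast i]
    norm_cast
    omega⟩
  sum_x j hj := ⟨_, zetaVal_mem_zetaAlg hj, hasSum_zetaVal_succ hj⟩
  sum_y j hj := ⟨_, mul_mem (add_mem (one_mem _) (pow_mem (neg_mem (one_mem _)) j))
    (zetaVal_mem_zetaAlg hj), hasSum_int_inv_pow hj⟩
  base := ⟨2, fun i => by
    have h := (Equiv.neg ℤ).hasSum_iff.2 (hasSum_inv_mul_inv_sub (k := i + 1) (by omega))
    refine hasSum_of_eq_of_eq h.neg (fun k => ?_) ?_
    · simp
    · simp⟩

theorem partialFractionPair_odd :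
    PartialFractionPair (fun i => (2 * i + 1 : ℝ)) (fun k => (2 * k + 1 : ℝ)) where
  ne_zero i := by positivity
  pole i := ⟨-(i + 1), fun k => by
    rw [← Int.cast_natCast i]
    norm_cast
    omega⟩
  sum_x j hj := ⟨_, lambdaVal_mem_zetaAlg hj, hasSum_lambdaVal hj⟩
  sum_y j hj := ⟨_, mul_mem (add_mem (one_mem _) (pow_mem (neg_mem (one_mem _)) j))
    (lambdaVal_mem_zetaAlg hj), hasSum_odd_int_inv_pow hj⟩
  base := ⟨1, fun i => by
    -- the substitution `k ↦ -1 - k` changes the sign of `2k + 1`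
    have h := (Equiv.subLeft (-1 : ℤ)).hasSum_iff.2 (hasSum_inv_odd_mul_inv_sub i)
    refine hasSum_of_eq_of_eq (h.mul_left (-(1 / 2))) (fun k => ?_) ?_
    · simp only [Function.comp_apply, Equiv.subLeft_apply]
      push_cast
      rw [show 2 * (-1 - (k : ℝ)) + 1 = -(2 * k + 1) by ring, inv_neg,
        show (2 * (i : ℝ) + 1 + (2 * k + 1)) = 2 * (i - (-1 - k)) by ring, mul_inv]
      ring
    · simp⟩

theorem exists_hasSum_int {p n : ℕ} (hp : 1 ≤ p) (hn : 1 ≤ n) :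
    ∃ f ∈ invPowSpan (fun i => (i + 1 : ℝ)) 1,
      ∀ i : ℕ, HasSum (fun k : ℤ => ((k : ℝ)⁻¹) ^ p * ((i + 1 + k : ℝ)⁻¹) ^ n) (f i) := by
  induction n, hn using Nat.le_induction generalizing p with
  | base => simpa using partialFractionPair_int.exists_hasSum_one hp
  | succ n hn ihn =>
    induction p, hp using Nat.le_induction with
    | base =>
      -- the substitution `k ↦ -(i + 1) - k` exchanges the two factors
      obtain ⟨f, hf, hfs⟩ := partialFractionPair_int.exists_hasSum_one (p := n + 1) (by omega)
      refine ⟨fun i => (-1) ^ n * f i, const_mul_mem_invPowSpan hf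
        (pow_mem (neg_mem (one_mem _)) n), fun i => ?_⟩
      have h := (Equiv.subLeft (-(i + 1) : ℤ)).hasSum_iff.2 (hfs i)
      refine hasSum_of_eq (h.mul_left ((-1) ^ n)) fun k => ?_
      simp only [Function.comp_apply, Equiv.subLeft_apply]
      push_cast
      rw [show -((i : ℝ) + 1) - k = -(i + 1 + k) by ring,
        show (i : ℝ) + 1 + -(i + 1 + k) = -k by ring, inv_neg, inv_neg, neg_pow _ (n + 1)]
      have e : (-1 : ℝ) ^ n * (-1) ^ n = 1 := by rw [← mul_pow]; norm_num
      linear_combination (((i + 1 + k : ℝ)⁻¹) ^ (n + 1) * (k : ℝ)⁻¹) * e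
    | succ p hp ihp =>
      obtain ⟨f, hf, hfs⟩ :=
        partialFractionPair_int.exists_hasSum_succ_succ hp hn (ihn (by omega)) ihp
      exact ⟨f, invPowSpan_anti _ (by omega) hf, hfs⟩

/-- The sums `∑_k (1 / aⁿ - 1 / (a + k)ⁿ) / kᵐ` for `a = i + 1` are combinations of inverse powers
of `a` with exponent at least two, hence summable over `a`. -/
theorem exists_hasSum_eulerTerm_int {n m : ℕ} (hn : 1 ≤ n) (hm : 2 ≤ m) :
    ∃ f ∈ invPowSpan (fun i => (i + 1 : ℝ)) 2,
      ∀ i : ℕ, HasSum (fun k : ℤ => eulerTerm n m (i + 1) k) (f i) := by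
  rcases hn.eq_or_lt with rfl | hn
  · obtain ⟨f, hf, hfs⟩ := partialFractionPair_int.exists_hasSum_inv_sub hm
    refine ⟨f, hf, fun i => hasSum_of_eq (hfs i) fun k => ?_⟩
    simp [eulerTerm]
  · obtain ⟨n, rfl⟩ : ∃ l, n = l + 1 := ⟨n - 1, by omega⟩
    obtain ⟨m, rfl⟩ : ∃ l, m = l + 1 := ⟨m - 1, by omega⟩
    obtain ⟨f, hf, hfs⟩ := partialFractionPair_int.exists_hasSum_succ_succ (s := 1) (p := m)
      (n := n) (by omega) (by omega) (exists_hasSum_int (by omega) (by omega))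
      (exists_hasSum_int (by omega) (by omega))
    obtain ⟨c, hc, hcs⟩ := partialFractionPair_int.sum_y (m + 1) hm
    refine ⟨fun i => c * ((i + 1 : ℝ)⁻¹) ^ (n + 1) - f i, sub_mem (const_mul_mem_invPowSpan
      (inv_pow_mem_invPowSpan _ (by omega)) hc) hf, fun i => ?_⟩
    refine hasSum_of_eq_of_eq ((hcs.mul_left (((i + 1 : ℝ)⁻¹) ^ (n + 1))).sub (hfs i))
      (fun k => ?_) (by ring)
    simp only [eulerTerm]
    push_cast
    ring

/-! ### The Euler sums `S` and the case of order one -/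

theorem tendsto_inv_succ_pow {n : ℕ} (hn : 1 ≤ n) :
    Filter.Tendsto (fun k : ℤ => ((k + 1 : ℝ)⁻¹) ^ n) Filter.atTop (nhds 0) := by
  simpa [show n ≠ 0 by omega] using (symmSumZero_inv.shift 1).top.pow n

theorem summable_eulerTerm_left {n m : ℕ} (hm : 2 ≤ m) {k : ℤ} (hk : k ≠ 0) :
    Summable fun i : ℕ => ((i + 1 : ℝ)⁻¹) ^ n - ((i + k + 1 : ℝ)⁻¹) ^ n := by
  have h := ((summable_eulerTerm n hm).prod_symm.prod_factor k).comp_injective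
    (i := fun i : ℕ => (i + 1 : ℤ)) fun i j h => by simpa using h
  have hk' : ((k : ℝ)⁻¹) ^ m ≠ 0 := pow_ne_zero _ (inv_ne_zero (by exact_mod_cast hk))
  refine ((summable_mul_left_iff hk').1 (h.congr fun i => ?_))
  simp only [Function.comp_apply, eulerTerm, Prod.swap]
  push_cast
  rw [add_right_comm]

theorem hasSum_sub_natCast {n : ℕ} (hn : 1 ≤ n) (k : ℕ) :
    HasSum (fun i : ℕ => ((i + 1 : ℝ)⁻¹) ^ n - ((i + k + 1 : ℝ)⁻¹) ^ n) (harm n k) := by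
  rcases eq_or_ne k 0 with rfl | hk
  · simp [harm, hasSum_zero]
  have h := hasSum_sub_shift_natCast (tendsto_inv_succ_pow hn) k
  refine hasSum_of_eq_of_eq (h ?_) (fun i => ?_) ?_
  · refine (summable_eulerTerm_left (n := n) le_rfl (k := k) (by exact_mod_cast hk)).congr
      fun i => ?_
    simp
  · simp
  · simp [harm_eq_sum_range]

/-- One of the subtracted terms is `0⁻¹ ^ n = 0`, which leaves `k` terms out of `k + 1`. -/
theorem hasSum_sub_neg_natCast {n : ℕ} (hn : 1 ≤ n) (k : ℕ) :
    HasSum (fun i : ℕ => ((i + 1 : ℝ)⁻¹) ^ n - ((i + -(k + 1) + 1 : ℝ)⁻¹) ^ n)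
      (-((-1) ^ n * harm n k)) := by
  have h := hasSum_sub_shift_neg_natCast (tendsto_inv_succ_pow hn) (k + 1)
  refine hasSum_of_eq_of_eq (h ?_) (fun i => ?_) ?_
  · refine (summable_eulerTerm_left (n := n) le_rfl (k := -((k + 1 : ℕ) : ℤ)) (by omega)).congr
      fun i => ?_
    simp
  · simp
  · rw [harm_eq_sum_range, Finset.mul_sum, Finset.sum_range_succ']
    simp only [Int.cast_neg, Int.cast_add, Int.cast_natCast, Int.cast_one, Nat.cast_zero,
      Int.cast_zero]
    -- the index `-1` is the pole of `k ↦ 1 / (k + 1)`, where the value is zero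
    rw [show (-((0 : ℝ) + 1) + 1)⁻¹ ^ n = 0 by simp [show n ≠ 0 by omega], add_zero]
    refine congrArg _ (Finset.sum_congr rfl fun i _ => ?_)
    rw [← mul_pow]
    push_cast
    rw [show -((i : ℝ) + 1 + 1) + 1 = -(i + 1) by ring, inv_neg, neg_one_mul]

/-- The terms with `k > 0` add up to `S_{n,m}`. For `k < 0` the harmonic number that occurs is
`H_{-k-1}`, whence the correction by `ζ(n + m)`. -/
theorem hasSum_eulerTerm_S {n m : ℕ} (hn : 1 ≤ n) (hm : 2 ≤ m) (hnm : Odd (n + m)) {f : ℕ → ℝ}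
    (hf : ∀ i : ℕ, HasSum (fun k : ℤ => eulerTerm n m (i + 1) k) (f i)) :
    HasSum f (2 * S n m - zetaVal (n + m)) := by
  have hF : Summable fun p : ℕ × ℤ => eulerTerm n m (p.1 + 1) p.2 :=
    (summable_eulerTerm n hm).comp_injective
      (i := fun p : ℕ × ℤ => ((p.1 + 1 : ℤ), p.2)) fun p q h => by
        simp only [Prod.mk.injEq] at h
        exact Prod.ext (by omega) (by omega)
  refine hasSum_of_hasSum_swap hF (h := fun k => ∑' i : ℕ, eulerTerm n m (i + 1) k)
    hf (fun k => (hF.prod_symm.prod_factor k).hasSum) ?_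
  have hS := converges_termS hn hm
  rw [show 2 * S n m - zetaVal (n + m) = S n m + (S n m - zetaVal (n + m)) by ring]
  refine HasSum.of_nat_of_neg_add_one ?_ ?_
  · refine hasSum_of_eq (hS.hasSum_series_of_zero (by simp [termS, harm])) fun k => ?_
    have h := (hasSum_sub_natCast hn k).mul_left (((k : ℝ)⁻¹) ^ m)
    refine ((hasSum_of_eq_of_eq h (fun i => ?_) ?_ : HasSum _ (termS n m k)).tsum_eq).symm
    · simp only [eulerTerm]
      push_cast
      rw [add_right_comm (i : ℝ) 1]
    · rw [termS, inv_pow, div_eq_mul_inv, mul_comm]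
  · refine hasSum_of_eq (hS.hasSum_series.sub (hasSum_zetaVal_succ (s := n + m) (by omega)))
      fun k => ?_
    have h := (hasSum_sub_neg_natCast hn k).mul_left (((-(k + 1) : ℝ)⁻¹) ^ m)
    refine ((hasSum_of_eq_of_eq h (fun i => ?_) ?_ : HasSum _ _).tsum_eq).symm
    · simp only [eulerTerm]
      push_cast
      rw [add_right_comm (i : ℝ) 1]
    · have e : (-1 : ℝ) ^ m * (-1) ^ n = -1 := by rw [← pow_add, add_comm m n, hnm.neg_one_pow]
      rw [termS, harm_succ, inv_neg, neg_pow ((k + 1 : ℝ)⁻¹)]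
      push_cast
      rw [div_eq_mul_inv, one_div, ← inv_pow, ← inv_pow, pow_add]
      linear_combination -(harm n k * ((k + 1 : ℝ)⁻¹) ^ m) * e

/-- Euler's theorem: in odd weight the sums `S_{n,m}` are polynomials in zeta values. -/
theorem S_mem_zetaAlg {n m : ℕ} (hn : 1 ≤ n) (hm : 2 ≤ m) (hnm : Odd (n + m)) :
    S n m ∈ zetaAlg := by
  obtain ⟨f, hf, hfs⟩ := exists_hasSum_eulerTerm_int hn hm
  obtain ⟨c, hc, hcs⟩ := exists_hasSum_of_mem_invPowSpan partialFractionPair_int.sum_x hf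
  have h := hcs.unique (hasSum_eulerTerm_S hn hm hnm hfs)
  have e : S n m = ((1 / 2 : ℚ) : ℝ) * (c + zetaVal (n + m)) := by
    push_cast
    linarith
  rw [e]
  exact mul_mem (ratCast_mem_zetaAlg _) (add_mem hc (zetaVal_mem_zetaAlg (by omega)))

/-- `∑_{x > 0} ∑_b (1 / x - 1 / (x + b)) / bᵐ` over odd `x > 0` and all odd `b`. For fixed
`b = ±(2k + 1)` the sum over `x` is `ln 2 + H_k / 2`. -/
theorem hasSum_eulerTerm_T6 {m : ℕ} (hm : 2 ≤ m) (hme : Even m) {f : ℕ → ℝ}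
    (hf : ∀ i : ℕ, HasSum
      (fun k : ℤ => ((2 * k + 1 : ℝ)⁻¹) ^ m * ((2 * i + 1 : ℝ)⁻¹ - (2 * i + 1 + (2 * k + 1) : ℝ)⁻¹))
      (f i)) :
    HasSum f (2 * (lambdaVal m * Real.log 2) + (T6 1 m - D 1 m)) := by
  have hF : Summable fun p : ℕ × ℤ => ((2 * p.2 + 1 : ℝ)⁻¹) ^ m *
      ((2 * p.1 + 1 : ℝ)⁻¹ - (2 * p.1 + 1 + (2 * p.2 + 1) : ℝ)⁻¹) := by
    refine ((summable_eulerTerm 1 hm).comp_injective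
      (i := fun p : ℕ × ℤ => ((2 * p.1 + 1 : ℤ), 2 * p.2 + 1)) fun p q h => by
        simp only [Prod.mk.injEq] at h
        exact Prod.ext (by omega) (by omega)).congr fun p => ?_
    simp [eulerTerm]
  refine hasSum_of_hasSum_swap hF (h := fun k : ℤ => ∑' i : ℕ, ((2 * k + 1 : ℝ)⁻¹) ^ m *
      ((2 * i + 1 : ℝ)⁻¹ - (2 * i + 1 + (2 * k + 1) : ℝ)⁻¹))
    hf (fun k => (hF.prod_symm.prod_factor k).hasSum) ?_
  have h6 := (converges_term6 (n := 1) le_rfl hm).hasSum_series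
  have hD := (converges_termD (n := 1) (m := m) (by omega)).hasSum_series
  have hhalf : HasSum (fun k : ℕ => ((2 * k + 1 : ℝ)⁻¹) ^ m * (Real.log 2 + 1 / 2 * harm 1 k))
      (lambdaVal m * Real.log 2 + 1 / 2 * (T6 1 m - D 1 m)) := by
    refine hasSum_of_eq (((hasSum_lambdaVal hm).mul_right (Real.log 2)).add
      ((h6.sub hD).mul_left (1 / 2))) fun k => ?_
    rw [term6, termD, harm_succ]
    push_cast
    rw [show 2 * ((k : ℝ) + 1) - 1 = 2 * k + 1 by ring, inv_pow]
    field_simp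
    ring
  rw [show 2 * (lambdaVal m * Real.log 2) + (T6 1 m - D 1 m) =
    (lambdaVal m * Real.log 2 + 1 / 2 * (T6 1 m - D 1 m)) +
      (lambdaVal m * Real.log 2 + 1 / 2 * (T6 1 m - D 1 m)) by ring]
  refine HasSum.of_nat_of_neg_add_one ?_ ?_
  · refine hasSum_of_eq hhalf fun k => ?_
    have h := ((hasSum_log_two.add ((hasSum_sub_natCast le_rfl k).mul_left (1 / 2)))).mul_left
      (((2 * k + 1 : ℝ)⁻¹) ^ m)
    refine (HasSum.tsum_eq (hasSum_of_eq h fun i => ?_)).symm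
    push_cast
    rw [show (2 * i + 1 + (2 * k + 1) : ℝ) = 2 * (i + k + 1) by ring, mul_inv, mul_inv]
    ring
  · refine hasSum_of_eq hhalf fun k => ?_
    have h := ((hasSum_log_two.add ((hasSum_sub_neg_natCast le_rfl k).mul_left (1 / 2)))).mul_left
      (((2 * k + 1 : ℝ)⁻¹) ^ m)
    refine (HasSum.tsum_eq (hasSum_of_eq_of_eq h (fun i => ?_) (by ring))).symm
    push_cast
    rw [show (2 * i + 1 + (2 * -((k : ℝ) + 1) + 1) : ℝ) = 2 * (i + -(k + 1) + 1) by ring,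
      show 2 * -((k : ℝ) + 1) + 1 = -(2 * k + 1) by ring, inv_neg, hme.neg_pow, mul_inv, mul_inv]
    ring

theorem T6_one_sub_D_one_mem {m : ℕ} (hm : 2 ≤ m) (hme : Even m) :
    T6 1 m - D 1 m ∈ zetaLogAlg := by
  obtain ⟨f, hf, hfs⟩ := partialFractionPair_odd.exists_hasSum_inv_sub hm
  obtain ⟨c, hc, hcs⟩ := exists_hasSum_of_mem_invPowSpan partialFractionPair_odd.sum_x hf
  have h := hcs.unique (hasSum_eulerTerm_T6 hm hme hfs)
  have e : T6 1 m - D 1 m = c - 2 * (lambdaVal m * Real.log 2) := by linarith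
  rw [e]
  exact sub_mem (zetaAlg_le_zetaLogAlg hc) (mul_mem (natCast_mem _ 2)
    (mul_mem (zetaAlg_le_zetaLogAlg (lambdaVal_mem_zetaAlg hm)) log_two_mem_zetaLogAlg))

theorem T6_one_mem_zetaLogAlg {m : ℕ} (hm : 2 ≤ m) (hme : Even m) : T6 1 m ∈ zetaLogAlg := by
  obtain ⟨r, hr⟩ := exists_D_sub_log_mem (n := 1) (m := m) le_rfl (by omega)
  have h := add_mem (add_mem (T6_one_sub_D_one_mem hm hme) (zetaAlg_le_zetaLogAlg hr))
    (mul_mem (zetaAlg_le_zetaLogAlg (ratCast_mem_zetaAlg r)) log_two_mem_zetaLogAlg)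
  convert h using 1
  ring

theorem one_div_two_pow_mem_zetaAlg (k : ℕ) : (1 / 2 ^ k : ℝ) ∈ zetaAlg := by
  simpa using ratCast_mem_zetaAlg (1 / 2 ^ k)

theorem T3_one_mem_zetaLogAlg {m : ℕ} (hm : 2 ≤ m) (hme : Even m) : T3 1 m ∈ zetaLogAlg := by
  have hodd : Odd (1 + m) := hme.one_add
  rw [T3_eq le_rfl hm]
  have h (k : ℕ) := zetaAlg_le_zetaLogAlg (one_div_two_pow_mem_zetaAlg k)
  exact sub_mem (sub_mem
    (mul_mem (sub_mem (one_mem _) (h _)) (zetaAlg_le_zetaLogAlg (S_mem_zetaAlg le_rfl hm hodd)))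
    (mul_mem (h _) (zetaAlg_le_zetaLogAlg (T1_mem_zetaAlg le_rfl hm hodd))))
    (mul_mem (h _) (T6_one_sub_D_one_mem hm hme))

theorem T3_mem_zetaAlg {n m : ℕ} (hn : 2 ≤ n) (hm : 2 ≤ m) (hnm : Odd (n + m)) :
    T3 n m ∈ zetaAlg := by
  rw [T3_eq (by omega) hm, T6_eq hn hm,
    show zetaVal n * lambdaVal m + D n m - T1 m n - D n m = zetaVal n * lambdaVal m - T1 m n by
      ring]
  have h := one_div_two_pow_mem_zetaAlg
  exact sub_mem (sub_mem
    (mul_mem (sub_mem (one_mem _) (h _)) (S_mem_zetaAlg (by omega) hm hnm))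
    (mul_mem (h _) (T1_mem_zetaAlg (by omega) hm hnm)))
    (mul_mem (h _) (sub_mem (mul_mem (zetaVal_mem_zetaAlg hn) (lambdaVal_mem_zetaAlg hm))
      (T1_mem_zetaAlg (by omega) hn (by rwa [add_comm]))))

theorem exists_T6_sub_log_mem {n m : ℕ} (hn : 2 ≤ n) (hm : 2 ≤ m) (hnm : Odd (n + m)) :
    ∃ r : ℚ, T6 n m - r * Real.log 2 ∈ zetaAlg := by
  obtain ⟨r, hr⟩ := exists_D_sub_log_mem (n := n) (m := m) (by omega) (by omega)
  refine ⟨r, ?_⟩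
  have h := sub_mem (add_mem (mul_mem (zetaVal_mem_zetaAlg hn) (lambdaVal_mem_zetaAlg hm)) hr)
    (T1_mem_zetaAlg (n := m) (m := n) (by omega) hn (by rwa [add_comm]))
  rw [T6_eq hn hm]
  convert h using 1
  ring

end OddEuler

theorem mainTheorem1 :
    -- convergence of all the series
    (∀ n m : ℕ, 1 ≤ n → 2 ≤ m → Odd (n + m) →
      Converges (term1 n m) ∧ Converges (term3 n m) ∧ Converges (term6 n m) ∧
      Converges (termS n m) ∧ Converges (termD n m)) ∧
    (∀ n m : ℕ, 2 ≤ n → 1 ≤ m → Odd (n + m) →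
      Converges (term2 n m) ∧ Converges (term4 n m) ∧ Converges (term5 n m)) ∧
    -- the recursion for the first family: starting values and recursion step
    (∀ q : ℕ, 1 ≤ q →
      T1 1 (2 * q) = ((2 : ℝ) ^ (2 * q + 1) - 1) / 4 * zetaVal (2 * q + 1)
        - 1 / 2 * ∑ j ∈ Finset.Icc 1 (q - 1),
            ((2 : ℝ) ^ (2 * j + 1) - 1) * zetaVal (2 * j + 1) * zetaVal (2 * q - 2 * j)) ∧
    (∀ n m : ℕ, 1 ≤ n → 2 ≤ m → Odd (n + 1 + m) →
      (n : ℝ) * T1 (n + 1) m =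
        2 * ∑ i ∈ Finset.Icc 1 (n / 2), lambdaVal (2 * i) * T1 (n + 1 - 2 * i) m
        + ∑ i ∈ Finset.Icc 1 ((m - 1) / 2), zetaVal (2 * i) * T1 n (m + 1 - 2 * i)
        - ((m : ℝ) + 1) / 2 * T1 n (m + 1)) ∧
    -- the reduction of the other families to the first one
    (∀ n m : ℕ, 2 ≤ n → 2 ≤ m → Odd (n + m) →
      T6 n m = zetaVal n * lambdaVal m + D n m - T1 m n) ∧
    (∀ n m : ℕ, 1 ≤ n → 2 ≤ m → Odd (n + m) →
      T3 n m = (1 - 1 / 2 ^ (n + m)) * S n m - 1 / 2 ^ m * T1 n m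
        - 1 / 2 ^ n * (T6 n m - D n m)) ∧
    (∀ n m : ℕ, 2 ≤ n → 1 ≤ m → Odd (n + m) →
      T2 n m = T6 m n ∧ T4 n m = T3 m n ∧ T5 n m = T1 m n) ∧
    -- the values are polynomials in zeta values
    (∀ n m : ℕ, 1 ≤ n → 2 ≤ m → Odd (n + m) → T1 n m ∈ zetaAlg) ∧
    (∀ n m : ℕ, 2 ≤ n → 1 ≤ m → Odd (n + m) → T5 n m ∈ zetaAlg) ∧
    (∀ n m : ℕ, 2 ≤ n → 2 ≤ m → Odd (n + m) →
      T3 n m ∈ zetaAlg ∧ T4 n m ∈ zetaAlg ∧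
      (∃ r : ℚ, T2 n m - (r : ℝ) * Real.log 2 ∈ zetaAlg) ∧
      (∃ r : ℚ, T6 n m - (r : ℝ) * Real.log 2 ∈ zetaAlg)) ∧
    -- when the order of the harmonic number is one, `ln 2` enters polynomially
    (∀ m : ℕ, 2 ≤ m → Odd (1 + m) → T3 1 m ∈ zetaLogAlg ∧ T6 1 m ∈ zetaLogAlg) ∧
    (∀ n : ℕ, 2 ≤ n → Odd (n + 1) → T2 n 1 ∈ zetaLogAlg ∧ T4 n 1 ∈ zetaLogAlg) := by

  refine ⟨fun n m hn hm _ => ⟨converges_term1 hn hm, converges_term3 hn hm, converges_term6 hn hm,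
      converges_termS hn hm, converges_termD (by omega)⟩,
    fun n m hn hm _ => ⟨converges_term6 hm hn, converges_term3 hm hn, converges_term1 hm hn⟩,
    fun q hq => T1_one hq, fun n m hn hm h => T1_recursion hn hm h,
    fun n m hn hm _ => T6_eq hn hm, fun n m hn hm _ => T3_eq hn hm,
    fun n m _ _ _ => ⟨rfl, rfl, rfl⟩, fun n m hn hm h => T1_mem_zetaAlg hn hm h,
    fun n m hn hm h => T1_mem_zetaAlg hm hn (by rwa [add_comm]), fun n m hn hm h => ?_,
    fun m hm h => ?_, fun n hn h => ?_⟩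
  · have h' : Odd (m + n) := by rwa [add_comm]
    exact ⟨T3_mem_zetaAlg hn hm h, T3_mem_zetaAlg hm hn h', exists_T6_sub_log_mem hm hn h',
      exists_T6_sub_log_mem hn hm h⟩
  · have hme : Even m := by rw [Nat.odd_iff] at h; rw [Nat.even_iff]; omega
    exact ⟨T3_one_mem_zetaLogAlg hm hme, T6_one_mem_zetaLogAlg hm hme⟩
  · have hne : Even n := by rw [Nat.odd_iff] at h; rw [Nat.even_iff]; omega
    exact ⟨T6_one_mem_zetaLogAlg hn hne, T3_one_mem_zetaLogAlg hn hne⟩
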